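/- Let $k$ be a commutative ring and $A$ a commutative $k$-algebra. A Hasse–Schmidt derivation of $A$ over $k$ (of infinite length) is a sequence $D=(D_n)_{n\ge 0}$ of $k$-linear maps $D_n:A\to A$ with $D_0=\mathrm{Id}_A$ and $D_n(xy)=\sum_{i+j=n}D_i(x)D_j(y)$ for all $n\ge 0$ and $x,y\in A$. A $k$-derivation $\delta$ of $A$ is integrable if $\delta=D_1$ for some such $D$; the integrable derivations form an $A$-submodule $\mathrm{IDer}_k(A)$ of $\mathrm{Der}_k(A)$. For $P\in\mathrm{End}_k(A)$ and $a\in A$ put $[P,a](x)=P(ax)-aP(x)$. Let $\mathcal D^{(0)}=\mathrm{Hom}_A(A,A)$ and $\mathcal D^{(n+1)}=\{P\in\mathrm{End}_k(A) : [P,a]\in\mathcal D^{(n)}\ \forall a\in A\}$ be the modules of $k$-linear differential operators of $A$ of order at most $n$, resp. $n+1$, put $\mathcal D^{(-1)}=0$, and let $\mathrm{gr}\,\mathcal D_{A/k}=\bigoplus_{n\ge 0}\mathcal D^{(n)}/\mathcal D^{(n-1)}$ be the associated commutative graded $A$-algebra; write $\sigma_n(P)$ for the class of $P\in\mathcal D^{(n)}$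 in degree $n$. Let $(\mathrm{Sym}\,\Omega_{A/k})^*_{gr}=\bigoplus_{n\ge 0}\mathrm{Hom}_A(\mathrm{Sym}^n_A\Omega_{A/k},A)$ be the graded dual of the symmetric algebra of the module of Kähler differentials, with the shuffle product, i.e. the transpose of the comultiplication of $\mathrm{Sym}\,\Omega_{A/k}$ for which the elements of $\Omega_{A/k}$ are primitive. Let $I$ be the kernel of the multiplication $A\otimes_kA\to A$, let $A$ act on $A\otimes_k A$ through the left factor, and let $\upsilon:\mathrm{Sym}\,\Omega_{A/k}\to\bigoplus_{n\ge0}I^n/I^{n+1}$ be the homomorphism of graded $A$-algebras with $\upsilon(da)=1\otimes a-a\otimes 1+I^2$. For $P\in\mathcal D^{(n)}$, the $A$-linear map $A\otimes_kA\to A$, $a\otimes b\mapsto aP(b)$, vanishes on $I^{n+1}$; let $\theta_n(\sigma_n(P))\in\mathrm{Hom}_A(\mathrm{Sym}^n_A\Omega_{A/k},A)$ be the composition of $\upsilon$ in degree $n$ with the induced map $I^n/I^{n+1}\to A$. Let $$\theta_{A/k}=\bigoplus_{n\ge 0}\theta_n:\ \mathrm{gr}\,\mathcal D_{A/k}\to(\mathrm{Sym}\,\Omega_{A/k})^*_{gr}.$$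 Let $\Gamma M$ denote the algebra of divided powers of an $A$-module $M$, with its canonical maps $\gamma_n:M\to\Gamma M$, and let $$\vartheta_{A/k}:\ \Gamma\,\mathrm{IDer}_k(A)\to\mathrm{gr}\,\mathcal D_{A/k}$$ be the homomorphism of $A$-algebras with $\vartheta_{A/k}(\gamma_n(\delta))=\sigma_n(D_n)$ for all $n\ge 0$ and every integrable $\delta$, where $D$ is any Hasse–Schmidt derivation with $D_1=\delta$ (the value does not depend on the choice of $D$). **Theorem.** Assume that $\mathrm{Der}_k(A)$ is a projective $A$-module of finite rank (finitely generated projective). Then the following properties are equivalent: (a) $\theta_{A/k}$ is an isomorphism of graded $A$-algebras; (b) $\vartheta_{A/k}$ is an isomorphism of graded $A$-algebras; (c) every $k$-derivation of $A$ is integrable, i.e. $\mathrm{IDer}_k(A)=\mathrm{Der}_k(A)$. -/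

import Mathlib

noncomputable section

open scoped TensorProduct DirectSum

namespace HSInt

section AssociatedGraded

variable {A R : Type*} [CommRing A] [Ring R] [Module A R]

/-- Compatibility of a family `F n` of submodules of a ring, and of subfamilies `G n ≤ F n`
(the next smaller step of the filtration), which makes `⨁ n, F n / G n` a commutative graded
ring. For an increasing filtration `G n = F (n - 1)`, for the `I`-adic one `G n = F (n + 1)`. -/
class IsGrPair (F G : ℕ → Submodule A R) : Prop where
  one_mem : (1 : R) ∈ F 0
  mul_mem : ∀ {i j : ℕ} {x y : R}, x ∈ F i → y ∈ F j → x * y ∈ F (i + j)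
  mul_mem_left : ∀ {i j : ℕ} {x y : R}, x ∈ F i → y ∈ G j → x * y ∈ G (i + j)
  mul_mem_right : ∀ {i j : ℕ} {x y : R}, x ∈ G i → y ∈ F j → x * y ∈ G (i + j)
  comm_mem : ∀ {i j : ℕ} {x y : R}, x ∈ F i → y ∈ F j → x * y - y * x ∈ G (i + j)

/-- The degree `n` piece `F n / G n` of the associated graded ring. -/
def GrPiece (F G : ℕ → Submodule A R) (n : ℕ) : Type _ :=
  ↥(F n) ⧸ (G n).submoduleOf (F n)

instance (F G : ℕ → Submodule A R) (n : ℕ) : AddCommGroup (GrPiece F G n) :=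
  inferInstanceAs (AddCommGroup (↥(F n) ⧸ (G n).submoduleOf (F n)))

instance GrPiece.module' {S : Type*} [Semiring S] [SMul S A] [Module S R] [IsScalarTower S A R]
    (F G : ℕ → Submodule A R) (n : ℕ) : Module S (GrPiece F G n) :=
  inferInstanceAs (Module S (↥(F n) ⧸ (G n).submoduleOf (F n)))

instance GrPiece.module (F G : ℕ → Submodule A R) (n : ℕ) : Module A (GrPiece F G n) :=
  GrPiece.module' F G n

instance {S : Type*} [Semiring S] [SMul S A] [Module S R] [IsScalarTower S A R]
    (F G : ℕ → Submodule A R) (n : ℕ) : IsScalarTower S A (GrPiece F G n) :=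
  inferInstanceAs (IsScalarTower S A (↥(F n) ⧸ (G n).submoduleOf (F n)))

/-- The class map `F n → F n / G n`. -/
def GrPiece.mk (F G : ℕ → Submodule A R) (n : ℕ) : ↥(F n) →ₗ[A] GrPiece F G n :=
  ((G n).submoduleOf (F n)).mkQ

/-- A linear map on `F n` that kills `G n` descends to `F n / G n`. -/
def GrPiece.lift {F G : ℕ → Submodule A R} {n : ℕ} {N : Type*} [AddCommGroup N] [Module A N]
    (f : ↥(F n) →ₗ[A] N) (hf : ∀ x : ↥(F n), (x : R) ∈ G n → f x = 0) :
    GrPiece F G n →ₗ[A] N :=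
  ((G n).submoduleOf (F n)).liftQ f fun x hx => hf x hx

theorem GrPiece.lift_mk {F G : ℕ → Submodule A R} {n : ℕ} {N : Type*} [AddCommGroup N]
    [Module A N] (f : ↥(F n) →ₗ[A] N) (hf : ∀ x : ↥(F n), (x : R) ∈ G n → f x = 0) (x : ↥(F n)) :
    GrPiece.lift f hf (GrPiece.mk F G n x) = f x := rfl

variable {F G : ℕ → Submodule A R}

theorem GrPiece.mk_surjective (n : ℕ) : Function.Surjective (GrPiece.mk F G n) :=
  Submodule.mkQ_surjective _

theorem GrPiece.mk_eq_mk {n : ℕ} {x y : ↥(F n)} :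
    GrPiece.mk F G n x = GrPiece.mk F G n y ↔ (x : R) - y ∈ G n :=
  Submodule.Quotient.eq _

theorem GrPiece.sigma_ext {i j : ℕ} (h : i = j) {x : ↥(F i)} {y : ↥(F j)}
    (hxy : (x : R) - y ∈ G i) :
    (⟨i, GrPiece.mk F G i x⟩ : GradedMonoid (GrPiece F G)) = ⟨j, GrPiece.mk F G j y⟩ := by
  subst h
  rw [GrPiece.mk_eq_mk.2 hxy]

variable [IsGrPair F G]

/-- Multiplication `F i / G i × F j / G j → F (i + j) / G (i + j)` induced by that of `R`. -/
def GrPiece.mul {i j : ℕ} (x : GrPiece F G i) (y : GrPiece F G j) : GrPiece F G (i + j) :=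
  Quotient.map₂ (sc := Submodule.quotientRel _)
    (fun (a : ↥(F i)) (b : ↥(F j)) =>
      (⟨(a : R) * b, IsGrPair.mul_mem (G := G) a.2 b.2⟩ : ↥(F (i + j))))
    (by
      intro a a' ha b b' hb
      have ha' : (a : R) - a' ∈ G i := (Submodule.quotientRel_def ((G i).submoduleOf (F i))).1 ha
      have hb' : (b : R) - b' ∈ G j := (Submodule.quotientRel_def ((G j).submoduleOf (F j))).1 hb
      refine (Submodule.quotientRel_def _).2 ?_
      change (a : R) * b - a' * b' ∈ G (i + j)
      have : (a : R) * b - a' * b' = (a - a') * b + a' * (b - b') := by noncomm_ring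
      rw [this]
      exact add_mem (IsGrPair.mul_mem_right ha' b.2) (IsGrPair.mul_mem_left a'.2 hb')) x y

instance GrPiece.gMul : GradedMonoid.GMul (GrPiece F G) where
  mul x y := GrPiece.mul x y

theorem GrPiece.mk_mul_mk {i j : ℕ} (x : ↥(F i)) (y : ↥(F j)) :
    GradedMonoid.GMul.mul (GrPiece.mk F G i x) (GrPiece.mk F G j y) =
      GrPiece.mk F G (i + j) ⟨(x : R) * y, IsGrPair.mul_mem (G := G) x.2 y.2⟩ := rfl

instance GrPiece.gOne : GradedMonoid.GOne (GrPiece F G) where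
  one := GrPiece.mk F G 0 ⟨1, IsGrPair.one_mem G⟩

instance GrPiece.gCommRing : DirectSum.GCommRing (GrPiece F G) where
  mul_zero {i j} x := by
    obtain ⟨x, rfl⟩ := GrPiece.mk_surjective i x
    rw [← map_zero (GrPiece.mk F G j), GrPiece.mk_mul_mk, ← map_zero (GrPiece.mk F G _),
      GrPiece.mk_eq_mk]
    simp
  zero_mul {i j} x := by
    obtain ⟨x, rfl⟩ := GrPiece.mk_surjective j x
    rw [← map_zero (GrPiece.mk F G i), GrPiece.mk_mul_mk, ← map_zero (GrPiece.mk F G _),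
      GrPiece.mk_eq_mk]
    simp
  mul_add {i j} x y z := by
    obtain ⟨x, rfl⟩ := GrPiece.mk_surjective i x
    obtain ⟨y, rfl⟩ := GrPiece.mk_surjective j y
    obtain ⟨z, rfl⟩ := GrPiece.mk_surjective j z
    rw [← map_add, GrPiece.mk_mul_mk, GrPiece.mk_mul_mk, GrPiece.mk_mul_mk, ← map_add,
      GrPiece.mk_eq_mk]
    simp [mul_add]
  add_mul {i j} x y z := by
    obtain ⟨x, rfl⟩ := GrPiece.mk_surjective i x
    obtain ⟨y, rfl⟩ := GrPiece.mk_surjective i y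
    obtain ⟨z, rfl⟩ := GrPiece.mk_surjective j z
    rw [← map_add, GrPiece.mk_mul_mk, GrPiece.mk_mul_mk, GrPiece.mk_mul_mk, ← map_add,
      GrPiece.mk_eq_mk]
    simp [add_mul]
  one_mul := by
    rintro ⟨i, x⟩
    obtain ⟨x, rfl⟩ := GrPiece.mk_surjective i x
    exact GrPiece.sigma_ext (zero_add i) (by simp)
  mul_one := by
    rintro ⟨i, x⟩
    obtain ⟨x, rfl⟩ := GrPiece.mk_surjective i x
    exact GrPiece.sigma_ext (add_zero i) (by simp)
  mul_assoc := by
    rintro ⟨i, x⟩ ⟨j, y⟩ ⟨l, z⟩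
    obtain ⟨x, rfl⟩ := GrPiece.mk_surjective i x
    obtain ⟨y, rfl⟩ := GrPiece.mk_surjective j y
    obtain ⟨z, rfl⟩ := GrPiece.mk_surjective l z
    exact GrPiece.sigma_ext (add_assoc i j l) (by simp [mul_assoc])
  mul_comm := by
    rintro ⟨i, x⟩ ⟨j, y⟩
    obtain ⟨x, rfl⟩ := GrPiece.mk_surjective i x
    obtain ⟨y, rfl⟩ := GrPiece.mk_surjective j y
    exact GrPiece.sigma_ext (add_comm i j) (IsGrPair.comm_mem x.2 y.2)
  natCast n := GrPiece.mk F G 0 (n • ⟨1, IsGrPair.one_mem G⟩)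
  natCast_zero := by simp
  natCast_succ n := by rw [succ_nsmul, map_add]; rfl
  intCast n := GrPiece.mk F G 0 (n • ⟨1, IsGrPair.one_mem G⟩)
  intCast_ofNat n := by simp
  intCast_negSucc_ofNat n := by rw [← map_neg, negSucc_zsmul]

instance GrPiece.gAlgebra [IsScalarTower A R R] : DirectSum.GAlgebra A (GrPiece F G) where
  toFun := ((GrPiece.mk F G 0).comp
    (LinearMap.toSpanSingleton A ↥(F 0) ⟨1, IsGrPair.one_mem G⟩)).toAddMonoidHom
  map_one := by
    change GrPiece.mk F G 0 ((1 : A) • _) = _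
    rw [one_smul]; rfl
  map_mul r s := by
    refine GrPiece.sigma_ext (zero_add 0).symm (x := (r * s) • (⟨1, IsGrPair.one_mem G⟩ : ↥(F 0)))
      (y := ⟨_, IsGrPair.mul_mem (G := G) (r • (⟨1, IsGrPair.one_mem G⟩ : ↥(F 0))).2
        (s • (⟨1, IsGrPair.one_mem G⟩ : ↥(F 0))).2⟩) ?_
    simp [mul_smul]
  commutes r := by
    rintro ⟨i, x⟩
    obtain ⟨x, rfl⟩ := GrPiece.mk_surjective i x
    exact GrPiece.sigma_ext (add_comm 0 i)
      (IsGrPair.comm_mem (r • (⟨1, IsGrPair.one_mem G⟩ : ↥(F 0))).2 x.2)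
  smul_def r := by
    rintro ⟨i, x⟩
    obtain ⟨x, rfl⟩ := GrPiece.mk_surjective i x
    refine GrPiece.sigma_ext (zero_add i).symm (x := r • x) ?_
    simp

end AssociatedGraded

section DifferentialOperators

variable (k : Type*) {A : Type*} [CommRing k] [CommRing A] [Algebra k A]

/-- `[P, a] = P a - a P` for a `k`-linear endomorphism `P` of `A` and `a ∈ A`, as a function of
`P`, linear for the left `A`-module structure `(b P)(x) = b P(x)`. -/
def bracket (a : A) : Module.End k A →ₗ[A] Module.End k A where
  toFun P := P ∘ₗ LinearMap.mulLeft k a - a • P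
  map_add' P Q := by ext x; simp; ring
  map_smul' b P := by ext x; simp; ring

variable {k} in
theorem bracket_apply (a : A) (P : Module.End k A) (x : A) :
    bracket k a P x = P (a * x) - a * P x := rfl

variable (A)

/-- The `A`-module of `k`-linear differential operators of order `≤ n` from `A` to `A`. -/
def diffOp : ℕ → Submodule A (Module.End k A)
  | 0 =>
    { carrier := {P | ∀ a x : A, P (a * x) = a * P x}
      add_mem' := fun {P Q} hP hQ a x => by simp [hP a x, hQ a x, mul_add]
      zero_mem' := fun a x => by simp
      smul_mem' := fun c P hP a x => by simp [hP a x, mul_left_comm] }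
  | n + 1 =>
    { carrier := {P | ∀ a : A, bracket k a P ∈ diffOp n}
      add_mem' := fun {P Q} hP hQ a => by rw [map_add]; exact add_mem (hP a) (hQ a)
      zero_mem' := fun a => by rw [map_zero]; exact zero_mem _
      smul_mem' := fun c P hP a => by rw [map_smul]; exact Submodule.smul_mem _ _ (hP a) }

/-- Differential operators of order `≤ n - 1`, with the convention `0` for `n = 0`. -/
def diffOpPred : ℕ → Submodule A (Module.End k A)
  | 0 => ⊥
  | n + 1 => diffOp k A n

variable {k A}

theorem mem_diffOpPred_succ {n : ℕ} {P : Module.End k A} :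
    P ∈ diffOpPred k A (n + 1) ↔ ∀ a : A, bracket k a P ∈ diffOpPred k A n := by
  cases n with
  | zero =>
    refine forall_congr' fun a => ?_
    change _ ↔ bracket k a P = 0
    rw [LinearMap.ext_iff]
    exact forall_congr' fun x => by rw [bracket_apply, LinearMap.zero_apply, sub_eq_zero]
  | succ n => exact Iff.rfl

theorem diffOpPred_le_succ (n : ℕ) : diffOpPred k A n ≤ diffOpPred k A (n + 1) := by
  induction n with
  | zero => exact bot_le
  | succ n ih =>
    intro P hP
    rw [mem_diffOpPred_succ] at hP ⊢
    exact fun a => ih (hP a)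

theorem diffOpPred_mono : Monotone (diffOpPred k A) := monotone_nat_of_le_succ diffOpPred_le_succ

theorem bracket_mul (a : A) (P Q : Module.End k A) :
    bracket k a (P * Q) = P * bracket k a Q + bracket k a P * Q := by
  ext x
  simp [bracket_apply]

theorem diffOpPred_mul_mem (s : ℕ) : ∀ (i j : ℕ), i + j = s → ∀ {P Q : Module.End k A},
    P ∈ diffOpPred k A i → Q ∈ diffOpPred k A j → P * Q ∈ diffOpPred k A (i + j - 1) := by
  induction s with
  | zero =>
    intro i j h P Q hP hQ
    obtain rfl : i = 0 := by omega
    rw [(Submodule.mem_bot A).1 hP, zero_mul]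
    exact zero_mem _
  | succ s ih =>
    intro i j h P Q hP hQ
    rcases i with _ | i
    · rw [(Submodule.mem_bot A).1 hP, zero_mul]
      exact zero_mem _
    rcases j with _ | j
    · rw [(Submodule.mem_bot A).1 hQ, mul_zero]
      exact zero_mem _
    have e : i + 1 + (j + 1) - 1 = (i + j) + 1 := by omega
    rw [e, mem_diffOpPred_succ]
    intro a
    rw [bracket_mul]
    refine add_mem ?_ ?_
    · have := ih (i + 1) j (by omega) hP (mem_diffOpPred_succ.1 hQ a)
      rwa [show i + 1 + j - 1 = i + j by omega] at this
    · have := ih i (j + 1) (by omega) (mem_diffOpPred_succ.1 hP a) hQ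
      rwa [show i + (j + 1) - 1 = i + j by omega] at this

theorem diffOpPred_comm_mem (s : ℕ) : ∀ (i j : ℕ), i + j = s → ∀ {P Q : Module.End k A},
    P ∈ diffOp k A i → Q ∈ diffOp k A j → P * Q - Q * P ∈ diffOpPred k A (i + j) := by
  induction s with
  | zero =>
    intro i j h P Q hP hQ
    obtain ⟨rfl, rfl⟩ : i = 0 ∧ j = 0 := by omega
    refine (Submodule.mem_bot A).2 (LinearMap.ext fun x => ?_)
    have h1 : ∀ x, P x = x * P 1 := fun x => by simpa using hP x 1
    have h2 : ∀ x, Q x = x * Q 1 := fun x => by simpa using hQ x 1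
    simp only [LinearMap.sub_apply, Module.End.mul_apply, LinearMap.zero_apply]
    rw [h1 (Q x), h2 (P x), h1 x, h2 x]
    ring
  | succ s ih =>
    intro i j h P Q hP hQ
    rw [h, mem_diffOpPred_succ]
    intro a
    have e : bracket k a (P * Q - Q * P) =
        (P * bracket k a Q - bracket k a Q * P) + (bracket k a P * Q - Q * bracket k a P) := by
      rw [map_sub, bracket_mul, bracket_mul]; abel
    rw [e]
    have hP' := mem_diffOpPred_succ.1 (show P ∈ diffOpPred k A (i + 1) from hP) a
    have hQ' := mem_diffOpPred_succ.1 (show Q ∈ diffOpPred k A (j + 1) from hQ) a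
    refine add_mem ?_ ?_
    · rcases j with _ | j
      · rw [(Submodule.mem_bot A).1 hQ', mul_zero, zero_mul, sub_zero]
        exact zero_mem _
      · have := ih i j (by omega) hP hQ'
        rwa [show i + j = s by omega] at this
    · rcases i with _ | i
      · rw [(Submodule.mem_bot A).1 hP', mul_zero, zero_mul, sub_zero]
        exact zero_mem _
      · have := ih i j (by omega) hP' hQ
        rwa [show i + j = s by omega] at this

instance diffOp_isGrPair : IsGrPair (diffOp k A) (diffOpPred k A) where
  one_mem := fun a x => rfl
  mul_mem {i j x y} hx hy := by
    have := diffOpPred_mul_mem _ (i + 1) (j + 1) rfl (P := x) (Q := y) hx hy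
    rwa [show i + 1 + (j + 1) - 1 = (i + j) + 1 by omega] at this
  mul_mem_left {i j x y} hx hy := by
    have := diffOpPred_mul_mem _ (i + 1) j rfl (P := x) (Q := y) hx hy
    rwa [show i + 1 + j - 1 = i + j by omega] at this
  mul_mem_right {i j x y} hx hy := by
    have := diffOpPred_mul_mem _ i (j + 1) rfl (P := x) (Q := y) hx hy
    rwa [show i + (j + 1) - 1 = i + j by omega] at this
  comm_mem hx hy := diffOpPred_comm_mem _ _ _ rfl hx hy

instance : IsScalarTower A (Module.End k A) (Module.End k A) :=
  ⟨fun a P Q => LinearMap.ext fun x => by simp⟩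

variable (k A)

/-- `gr^n D_{A/k}`: operators of order `≤ n` modulo operators of order `≤ n - 1`. -/
abbrev GrDiffPiece (n : ℕ) : Type _ := GrPiece (diffOp k A) (diffOpPred k A) n

/-- The commutative graded `A`-algebra `gr D_{A/k}`. -/
abbrev GrDiff : Type _ := ⨁ n, GrPiece (diffOp k A) (diffOpPred k A) n

variable {k A}

/-- The symbol `σ_n(P)`, as a homogeneous element of degree `n` of `gr D_{A/k}`. -/
def symbol (n : ℕ) (P : ↥(diffOp k A n)) : GrDiff k A :=
  DirectSum.of (GrPiece (diffOp k A) (diffOpPred k A)) n (GrPiece.mk _ _ n P)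

theorem symbol_eq {n : ℕ} {P Q : ↥(diffOp k A n)}
    (h : (P : Module.End k A) - Q ∈ diffOpPred k A n) : symbol n P = symbol n Q := by
  rw [symbol, symbol, GrPiece.mk_eq_mk.2 h]

theorem symbol_mul {i j : ℕ} (P : ↥(diffOp k A i)) (Q : ↥(diffOp k A j)) :
    symbol i P * symbol j Q =
      symbol (i + j) ⟨(P : Module.End k A) * (Q : Module.End k A),
        IsGrPair.mul_mem (G := diffOpPred k A) P.2 Q.2⟩ := by
  rw [symbol, symbol, DirectSum.of_mul_of, GrPiece.mk_mul_mk]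
  rfl

theorem symbol_add {n : ℕ} (P Q : ↥(diffOp k A n)) :
    symbol n (P + Q) = symbol n P + symbol n Q := by
  rw [symbol, map_add, map_add]; rfl

theorem symbol_smul {n : ℕ} (a : A) (P : ↥(diffOp k A n)) :
    symbol n (a • P) = a • symbol n P := by
  rw [symbol, map_smul]
  exact (DirectSum.lof A ℕ (GrPiece (diffOp k A) (diffOpPred k A)) n).map_smul a _

end DifferentialOperators

section HasseSchmidt

variable (k A : Type*) [CommRing k] [CommRing A] [Algebra k A]

/-- Hasse--Schmidt derivations of `A` over `k`, of infinite length. -/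
structure HasseSchmidt where
  /-- The components of the sequence. -/
  D : ℕ → Module.End k A
  zero_eq : D 0 = 1
  leibniz : ∀ (n : ℕ) (x y : A),
    D n (x * y) = ∑ p ∈ Finset.HasAntidiagonal.antidiagonal n, D p.1 x * D p.2 y

variable {k A}

/-- A `k`-derivation is integrable if it is the component of degree one of a Hasse--Schmidt
derivation of infinite length. -/
def IsIntegrable (δ : Derivation k A A) : Prop :=
  ∃ D : HasseSchmidt k A, D.D 1 = (δ : A →ₗ[k] A)

namespace HasseSchmidt

theorem bracket_eq (D : HasseSchmidt k A) (n : ℕ) (a : A) :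
    bracket k a (D.D n) = ∑ i ∈ Finset.range n, D.D (n - i) a • D.D i := by
  ext x
  rw [bracket_apply, mul_comm a x, D.leibniz,
    Finset.Nat.sum_antidiagonal_eq_sum_range_succ (fun i j => D.D i x * D.D j a),
    Finset.sum_range_succ]
  simp [D.zero_eq, mul_comm]

theorem mem_diffOp (D : HasseSchmidt k A) (n : ℕ) : D.D n ∈ diffOp k A n := by
  induction n using Nat.strong_induction_on with
  | _ n ih =>
    change D.D n ∈ diffOpPred k A (n + 1)
    rw [mem_diffOpPred_succ]
    intro a
    rw [D.bracket_eq]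
    refine sum_mem fun i hi => Submodule.smul_mem _ _ ?_
    have hi' := Finset.mem_range.1 hi
    exact diffOpPred_mono (show i + 1 ≤ n by omega) (ih i hi')

/-- The coefficient of degree `n` of the total symbol of a Hasse--Schmidt derivation. -/
def totalSymbol (D : HasseSchmidt k A) (n : ℕ) : GrDiff k A := symbol n ⟨D.D n, D.mem_diffOp n⟩

theorem sub_mem_of_one_eq {D E : HasseSchmidt k A} (h : D.D 1 = E.D 1) (n : ℕ) :
    D.D n - E.D n ∈ diffOpPred k A n := by
  induction n with
  | zero => rw [D.zero_eq, E.zero_eq, sub_self]; exact zero_mem _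
  | succ n ih =>
    rw [mem_diffOpPred_succ]
    intro a
    rw [map_sub, D.bracket_eq, E.bracket_eq, Finset.sum_range_succ, Finset.sum_range_succ,
      add_sub_add_comm]
    have lower : ∀ B : HasseSchmidt k A,
        ∑ i ∈ Finset.range n, B.D (n + 1 - i) a • B.D i ∈ diffOpPred k A n := fun B =>
      sum_mem fun i hi => Submodule.smul_mem _ _
        (diffOpPred_mono (show i + 1 ≤ n from Finset.mem_range.1 hi) (B.mem_diffOp i))
    refine add_mem (sub_mem (lower D) (lower E)) ?_
    rw [show n + 1 - n = 1 by omega, h]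
    convert Submodule.smul_mem _ (E.D 1 a) ih using 1
    ext x
    simp [mul_sub]

theorem totalSymbol_congr {D E : HasseSchmidt k A} (h : D.D 1 = E.D 1) (n : ℕ) :
    D.totalSymbol n = E.totalSymbol n :=
  symbol_eq (sub_mem_of_one_eq h n)

theorem mul_sub_mem (D : HasseSchmidt k A) (s : ℕ) : ∀ i j : ℕ, i + j = s →
    D.D i * D.D j - (s.choose i) • D.D s ∈ diffOpPred k A s := by
  induction s with
  | zero =>
    intro i j h
    obtain ⟨rfl, rfl⟩ : i = 0 ∧ j = 0 := by omega
    simp only [D.zero_eq]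
    simp
  | succ s ih =>
    intro i j h
    rcases i with _ | i
    · obtain rfl : j = s + 1 := by omega
      have : D.D 0 * D.D (s + 1) - (Nat.choose (s + 1) 0) • D.D (s + 1) = 0 := by
        ext x; simp [D.zero_eq]
      rw [this]
      exact zero_mem _
    rcases j with _ | j
    · obtain rfl : i = s := by omega
      have : D.D (i + 1) * D.D 0 - (Nat.choose (i + 1) (i + 1)) • D.D (i + 1) = 0 := by
        ext x; simp [D.zero_eq]
      rw [this]
      exact zero_mem _
    obtain rfl : s = i + j + 1 := by omega
    -- modulo operators of lower order, `[D_{n+1}, a]` is `D_1(a) D_n`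
    have low : ∀ (n : ℕ) (a : A),
        bracket k a (D.D (n + 1)) - D.D 1 a • D.D n ∈ diffOpPred k A n := by
      intro n a
      rw [D.bracket_eq, Finset.sum_range_succ, show n + 1 - n = 1 by omega, add_sub_cancel_right]
      exact sum_mem fun l hl => Submodule.smul_mem _ _
        (diffOpPred_mono (show l + 1 ≤ n from Finset.mem_range.1 hl) (D.mem_diffOp l))
    rw [mem_diffOpPred_succ]
    intro a
    rw [map_sub, map_nsmul, bracket_mul]
    have h1 : D.D (i + 1) * (bracket k a (D.D (j + 1)) - D.D 1 a • D.D j) ∈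
        diffOpPred k A (i + j + 1) := by
      have := IsGrPair.mul_mem_left (G := diffOpPred k A) (D.mem_diffOp (i + 1)) (low j a)
      rwa [show i + 1 + j = i + j + 1 by omega] at this
    have h2 : (bracket k a (D.D (i + 1)) - D.D 1 a • D.D i) * D.D (j + 1) ∈
        diffOpPred k A (i + j + 1) := by
      rw [add_assoc]
      exact IsGrPair.mul_mem_right (F := diffOp k A) (low i a) (D.mem_diffOp (j + 1))
    have h3 := low (i + j + 1) a
    have h4 : D.D (i + 1) * (D.D 1 a • D.D j) - D.D 1 a • (D.D (i + 1) * D.D j) ∈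
        diffOpPred k A (i + j + 1) := by
      have e : D.D (i + 1) * (D.D 1 a • D.D j) - D.D 1 a • (D.D (i + 1) * D.D j) =
          bracket k (D.D 1 a) (D.D (i + 1)) * D.D j := by
        ext x; simp [bracket_apply]
      rw [e]
      have := IsGrPair.mul_mem_right (F := diffOp k A) (G := diffOpPred k A)
        (mem_diffOpPred_succ.1 (D.mem_diffOp (i + 1)) (D.D 1 a)) (D.mem_diffOp j)
      rwa [show i + 1 + j = i + j + 1 by omega] at this
    have h5 := ih (i + 1) j (by omega)
    have h6 := ih i (j + 1) (by omega)
    have e : D.D (i + 1) * bracket k a (D.D (j + 1)) + bracket k a (D.D (i + 1)) * D.D (j + 1) -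
        ((i + j + 1 + 1).choose (i + 1)) • bracket k a (D.D (i + j + 1 + 1)) =
        D.D (i + 1) * (bracket k a (D.D (j + 1)) - D.D 1 a • D.D j) +
        (bracket k a (D.D (i + 1)) - D.D 1 a • D.D i) * D.D (j + 1) -
        ((i + j + 1 + 1).choose (i + 1)) •
          (bracket k a (D.D (i + j + 1 + 1)) - D.D 1 a • D.D (i + j + 1)) +
        (D.D (i + 1) * (D.D 1 a • D.D j) - D.D 1 a • (D.D (i + 1) * D.D j)) +
        D.D 1 a • (D.D (i + 1) * D.D j - ((i + j + 1).choose (i + 1)) • D.D (i + j + 1)) +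
        D.D 1 a • (D.D i * D.D (j + 1) - ((i + j + 1).choose i) • D.D (i + j + 1)) := by
      rw [Nat.choose_succ_succ (i + j + 1) i]
      ext x
      simp
      ring
    rw [e]
    exact add_mem (add_mem (add_mem (sub_mem (add_mem h1 h2) (Submodule.smul_of_tower_mem _ _ h3))
      h4) (Submodule.smul_mem _ _ h5)) (Submodule.smul_mem _ _ h6)

theorem totalSymbol_mul (D : HasseSchmidt k A) (i j : ℕ) :
    D.totalSymbol i * D.totalSymbol j = ((i + j).choose i) • D.totalSymbol (i + j) := by
  have e : ((i + j).choose i) • D.totalSymbol (i + j) =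
      symbol (i + j) (((i + j).choose i) • ⟨D.D (i + j), D.mem_diffOp (i + j)⟩) := by
    rw [totalSymbol, symbol, symbol, map_nsmul, map_nsmul]
  rw [e, totalSymbol, totalSymbol, symbol_mul]
  exact symbol_eq (D.mul_sub_mem _ i j rfl)

theorem totalSymbol_zero (D : HasseSchmidt k A) : D.totalSymbol 0 = 1 := by
  have : (⟨D.D 0, D.mem_diffOp 0⟩ : ↥(diffOp k A 0)) =
      ⟨1, IsGrPair.one_mem (diffOpPred k A)⟩ := Subtype.ext D.zero_eq
  rw [totalSymbol, this]
  rfl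

/-- The Hasse--Schmidt derivation `a • D = (a ^ n D_n)_n`. -/
def smul (a : A) (D : HasseSchmidt k A) : HasseSchmidt k A where
  D n := a ^ n • D.D n
  zero_eq := by simp [D.zero_eq]
  leibniz n x y := by
    simp only [LinearMap.smul_apply, D.leibniz, smul_eq_mul, Finset.mul_sum]
    refine Finset.sum_congr rfl fun p hp => ?_
    rw [← Finset.HasAntidiagonal.mem_antidiagonal.1 hp, pow_add]
    ring

/-- The composition `(D ∘ E)_n = ∑_{i + j = n} D_i ∘ E_j` of Hasse--Schmidt derivations. -/
def comp (D E : HasseSchmidt k A) : HasseSchmidt k A where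
  D n := ∑ p ∈ Finset.HasAntidiagonal.antidiagonal n, D.D p.1 * E.D p.2
  zero_eq := by simp [D.zero_eq, E.zero_eq]
  leibniz n x y := by
    simp only [LinearMap.sum_apply, Module.End.mul_apply, D.leibniz, E.leibniz, map_sum,
      Finset.sum_mul_sum, Finset.sum_sigma']
    refine Finset.sum_nbij'
      (fun z => ⟨(z.2.2.1 + z.2.1.1, z.2.2.2 + z.2.1.2), (z.2.2.1, z.2.1.1), (z.2.2.2, z.2.1.2)⟩)
      (fun z => ⟨(z.2.1.1 + z.2.2.1, z.2.1.2 + z.2.2.2), (z.2.1.2, z.2.2.2), (z.2.1.1, z.2.2.1)⟩)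
      ?_ ?_ ?_ ?_ ?_
    · rintro ⟨⟨a, b⟩, ⟨c, d⟩, ⟨e, f⟩⟩ h
      simp only [Finset.mem_sigma, Finset.HasAntidiagonal.mem_antidiagonal] at h ⊢
      exact ⟨by omega, trivial, trivial⟩
    · rintro ⟨⟨a, b⟩, ⟨c, d⟩, ⟨e, f⟩⟩ h
      simp only [Finset.mem_sigma, Finset.HasAntidiagonal.mem_antidiagonal] at h ⊢
      exact ⟨by omega, trivial, trivial⟩
    · rintro ⟨⟨a, b⟩, ⟨c, d⟩, ⟨e, f⟩⟩ h
      simp only [Finset.mem_sigma, Finset.HasAntidiagonal.mem_antidiagonal] at h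
      obtain ⟨h1, rfl, rfl⟩ := h
      rfl
    · rintro ⟨⟨a, b⟩, ⟨c, d⟩, ⟨e, f⟩⟩ h
      simp only [Finset.mem_sigma, Finset.HasAntidiagonal.mem_antidiagonal] at h
      obtain ⟨h1, rfl, rfl⟩ := h
      rfl
    · rintro ⟨⟨a, b⟩, ⟨c, d⟩, ⟨e, f⟩⟩ h
      rfl

/-- The trivial Hasse--Schmidt derivation `(id, 0, 0, …)`. -/
def one : HasseSchmidt k A where
  D n := if n = 0 then 1 else 0
  zero_eq := by simp
  leibniz n x y := by
    rcases n with _ | n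
    · simp
    · rw [if_neg (by omega)]
      symm
      refine Finset.sum_eq_zero fun p hp => ?_
      have := Finset.HasAntidiagonal.mem_antidiagonal.1 hp
      rcases Nat.eq_zero_or_pos p.1 with h | h
      · simp [show p.2 ≠ 0 by omega]
      · simp [show p.1 ≠ 0 by omega]

theorem smul_one_eq (a : A) (D : HasseSchmidt k A) : (smul a D).D 1 = a • D.D 1 := by
  simp [smul]

theorem comp_one_eq (D E : HasseSchmidt k A) : (comp D E).D 1 = D.D 1 + E.D 1 := by
  ext x
  simp [comp, Finset.Nat.antidiagonal_succ, D.zero_eq, E.zero_eq, add_comm]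

theorem totalSymbol_smul (a : A) (D : HasseSchmidt k A) (n : ℕ) :
    (smul a D).totalSymbol n = a ^ n • D.totalSymbol n := by
  rw [totalSymbol, totalSymbol, ← symbol_smul]
  rfl

theorem totalSymbol_comp (D E : HasseSchmidt k A) (n : ℕ) :
    (comp D E).totalSymbol n =
      ∑ p ∈ Finset.HasAntidiagonal.antidiagonal n, D.totalSymbol p.1 * E.totalSymbol p.2 := by
  have key : ∀ p ∈ Finset.HasAntidiagonal.antidiagonal n, ∃ h : D.D p.1 * E.D p.2 ∈ diffOp k A n,
      D.totalSymbol p.1 * E.totalSymbol p.2 = symbol n ⟨D.D p.1 * E.D p.2, h⟩ := by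
    rintro ⟨i, j⟩ hp
    obtain rfl : i + j = n := Finset.HasAntidiagonal.mem_antidiagonal.1 hp
    exact ⟨_, symbol_mul _ _⟩
  rw [← Finset.sum_attach]
  rw [Finset.sum_congr rfl fun p _ => (key p.1 p.2).2]
  have hs : ∀ (s : Finset {p // p ∈ Finset.HasAntidiagonal.antidiagonal n}) (f : _ → ↥(diffOp k A n)),
      ∑ p ∈ s, symbol n (f p) = symbol n (∑ p ∈ s, f p) := by
    intro s f
    simp only [symbol, map_sum]
  rw [hs]
  refine congrArg (symbol n) (Subtype.ext ?_)
  simp only [comp, AddSubmonoidClass.coe_finsetSum]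
  exact (Finset.sum_attach _ fun p : ℕ × ℕ => D.D p.1 * E.D p.2).symm

end HasseSchmidt

variable (k A)

/-- The `A`-module `IDer_k(A)` of integrable `k`-derivations of `A`. -/
def IDer : Submodule A (Derivation k A A) where
  carrier := {δ | IsIntegrable δ}
  add_mem' := by
    rintro δ ε ⟨D, hD⟩ ⟨E, hE⟩
    exact ⟨D.comp E, by rw [HasseSchmidt.comp_one_eq, hD, hE]; rfl⟩
  zero_mem' := ⟨HasseSchmidt.one, by ext; simp [HasseSchmidt.one]⟩
  smul_mem' := by
    rintro a δ ⟨D, hD⟩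
    exact ⟨D.smul a, by rw [HasseSchmidt.smul_one_eq, hD]; rfl⟩

variable {k A}

/-- The coefficient of degree `n` of `χ(δ)`: the coefficient of the total symbol of any
Hasse--Schmidt derivation that integrates `δ`. -/
def chi (δ : IDer k A) (n : ℕ) : GrDiff k A := (Classical.choose δ.2).totalSymbol n

theorem chi_eq (δ : IDer k A) (D : HasseSchmidt k A)
    (hD : D.D 1 = ((δ : Derivation k A A) : A →ₗ[k] A)) (n : ℕ) : chi δ n = D.totalSymbol n :=
  HasseSchmidt.totalSymbol_congr ((Classical.choose_spec δ.2).trans hD.symm) n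

theorem chi_zero (δ : IDer k A) : chi δ 0 = 1 := HasseSchmidt.totalSymbol_zero _

theorem chi_smul (n : ℕ) (a : A) (δ : IDer k A) : chi (a • δ) n = a ^ n • chi δ n := by
  obtain ⟨D, hD⟩ := δ.2
  rw [chi_eq δ D hD, chi_eq (a • δ) (D.smul a)
    (by rw [HasseSchmidt.smul_one_eq, hD]; rfl), HasseSchmidt.totalSymbol_smul]

theorem chi_mul (n p : ℕ) (δ : IDer k A) :
    chi δ n * chi δ p = ((n + p).choose n) • chi δ (n + p) :=
  HasseSchmidt.totalSymbol_mul _ _ _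

theorem chi_add (n : ℕ) (δ ε : IDer k A) :
    chi (δ + ε) n = ∑ p ∈ Finset.HasAntidiagonal.antidiagonal n, chi δ p.1 * chi ε p.2 := by
  obtain ⟨D, hD⟩ := δ.2
  obtain ⟨E, hE⟩ := ε.2
  rw [chi_eq (δ + ε) (D.comp E) (by rw [HasseSchmidt.comp_one_eq, hD, hE]; rfl),
    HasseSchmidt.totalSymbol_comp]
  exact Finset.sum_congr rfl fun p _ => by rw [chi_eq δ D hD, chi_eq ε E hE]

variable (k A)

/-- The homomorphism of `A`-algebras `ϑ_{A/k} : Γ IDer_k(A) → gr D_{A/k}` that sends the divided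
power `γ_n(δ)` of an integrable derivation `δ` to `σ_n(D_n)`, for any Hasse--Schmidt derivation
`D` with `D_1 = δ`. -/
def vartheta : DividedPowerAlgebra A (IDer k A) →ₐ[A] GrDiff k A :=
  DividedPowerAlgebra.lift' (f := fun p : ℕ × IDer k A => chi p.2 p.1)
    (fun δ => chi_zero δ) (fun n a δ => chi_smul n a δ) (fun n p δ => chi_mul n p δ)
    (fun n δ ε => chi_add n δ ε)

end HasseSchmidt

section GradedDual

open SymmetricAlgebra WithConv

variable (A M : Type*) [CommRing A] [AddCommGroup M] [Module A M]

/-- The homogeneous component `Sym^n M` of degree `n` of the symmetric algebra of `M`. -/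
def symPiece (n : ℕ) : Submodule A (SymmetricAlgebra A M) :=
  LinearMap.range (SymmetricAlgebra.ι A M) ^ n

/-- The homomorphism `Sym M → (Sym M)[X]` that sends `x ∈ Sym^n M` to `x X^n`. -/
def symGrading : SymmetricAlgebra A M →ₐ[A] Polynomial (SymmetricAlgebra A M) :=
  SymmetricAlgebra.lift
    ((Polynomial.monomial (R := SymmetricAlgebra A M) 1).restrictScalars A ∘ₗ
      SymmetricAlgebra.ι A M)

variable {A M}

theorem symGrading_of_mem {n : ℕ} {s : SymmetricAlgebra A M} (hs : s ∈ symPiece A M n) :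
    symGrading A M s = Polynomial.monomial n s := by
  induction hs using Submodule.pow_induction_on_left' with
  | algebraMap r =>
    rw [AlgHom.commutes]
    rfl
  | add x y i hx hy ihx ihy => rw [map_add, ihx, ihy, map_add]
  | mem_mul m hm i x hx ih =>
    obtain ⟨m, rfl⟩ := hm
    rw [map_mul, ih, symGrading, SymmetricAlgebra.lift_ι_apply]
    simp [Polynomial.monomial_mul_monomial, add_comm]

theorem symPiece_iSup : ⨆ n, symPiece A M n = ⊤ := by
  rw [eq_top_iff]
  rintro s -
  have hone : ∀ n, symPiece A M n ≤ ⨆ n, symPiece A M n := le_iSup _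
  induction s using SymmetricAlgebra.induction with
  | algebraMap r =>
    refine hone 0 ?_
    rw [symPiece, pow_zero]
    exact Submodule.algebraMap_mem r
  | ι x =>
    refine hone 1 ?_
    rw [symPiece, pow_one]
    exact ⟨x, rfl⟩
  | add a b ha hb => exact add_mem ha hb
  | mul a b ha hb =>
    have h := Submodule.mul_mem_mul ha hb
    rw [Submodule.iSup_mul] at h
    refine (iSup_le fun i => ?_ : _ ≤ ⨆ n, symPiece A M n) h
    rw [Submodule.mul_iSup]
    refine iSup_le fun j => ?_
    rw [symPiece, symPiece, ← pow_add]
    exact hone (i + j)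

/-- Linear maps on `Sym M` that agree on all homogeneous components are equal. -/
theorem symPiece_hom_ext {N : Type*} [AddCommGroup N] [Module A N]
    {f g : SymmetricAlgebra A M →ₗ[A] N} (h : ∀ n, ∀ s ∈ symPiece A M n, f s = g s) : f = g := by
  have : (⊤ : Submodule A (SymmetricAlgebra A M)) ≤ LinearMap.eqLocus f g := by
    rw [← symPiece_iSup]
    exact iSup_le fun n s hs => h n s hs
  exact LinearMap.ext fun s => this trivial

theorem symGrading_coeff_mem (n : ℕ) (s : SymmetricAlgebra A M) :
    (symGrading A M s).coeff n ∈ symPiece A M n := by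
  have hs : s ∈ ⨆ n, symPiece A M n := by rw [symPiece_iSup]; trivial
  induction hs using Submodule.iSup_induction' with
  | mem i x hx =>
    rw [symGrading_of_mem hx, Polynomial.coeff_monomial]
    split_ifs with h
    · exact h ▸ hx
    · exact zero_mem _
  | zero => simp
  | add x y _ _ hx hy => rw [map_add, Polynomial.coeff_add]; exact add_mem hx hy

variable (A M) in
/-- The projection of `Sym M` onto `Sym^n M`. -/
def symProj (n : ℕ) : SymmetricAlgebra A M →ₗ[A] ↥(symPiece A M n) :=
  LinearMap.codRestrict (symPiece A M n)
    ((Polynomial.lcoeff (SymmetricAlgebra A M) n).restrictScalars A ∘ₗ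
      (symGrading A M).toLinearMap)
    (symGrading_coeff_mem n)

theorem symProj_same {n : ℕ} (s : ↥(symPiece A M n)) : symProj A M n s = s := by
  refine Subtype.ext ?_
  change (symGrading A M s).coeff n = s
  rw [symGrading_of_mem s.2, Polynomial.coeff_monomial_same]

theorem symProj_of_ne {n m : ℕ} (h : m ≠ n) {s : SymmetricAlgebra A M}
    (hs : s ∈ symPiece A M m) : symProj A M n s = 0 := by
  refine Subtype.ext ?_
  change (symGrading A M s).coeff n = 0
  rw [symGrading_of_mem hs, Polynomial.coeff_monomial, if_neg h]

variable (A M)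

/-- `(Sym^n M)^*`, the `A`-linear dual of `Sym^n M`. -/
def DualPiece (n : ℕ) : Type _ := Module.Dual A ↥(symPiece A M n)

instance (n : ℕ) : AddCommGroup (DualPiece A M n) :=
  inferInstanceAs (AddCommGroup (Module.Dual A ↥(symPiece A M n)))

instance (n : ℕ) : Module A (DualPiece A M n) :=
  inferInstanceAs (Module A (Module.Dual A ↥(symPiece A M n)))

/-- The graded dual `(Sym M)^*_gr = ⨁ n, (Sym^n M)^*`. -/
abbrev GradedDual : Type _ := ⨁ n, DualPiece A M n

variable {A M}

/-- Extension by zero of a linear form on `Sym^n M` to `Sym M`. The dual of `Sym M` carries the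
convolution product, which is the transpose of the comultiplication of `Sym M` determined by
`Δ(x) = x ⊗ 1 + 1 ⊗ x` for `x ∈ M`. -/
def DualPiece.extend {n : ℕ} (u : DualPiece A M n) : WithConv (SymmetricAlgebra A M →ₗ[A] A) :=
  toConv (LinearMap.comp (show ↥(symPiece A M n) →ₗ[A] A from u) (symProj A M n))

/-- Restriction of a linear form on `Sym M` to `Sym^n M`. -/
def DualPiece.restrict (n : ℕ) (f : WithConv (SymmetricAlgebra A M →ₗ[A] A)) : DualPiece A M n :=
  LinearMap.comp f.ofConv (symPiece A M n).subtype

theorem DualPiece.restrict_extend {n : ℕ} (u : DualPiece A M n) :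
    DualPiece.restrict n u.extend = u := by
  refine LinearMap.ext fun s => ?_
  exact congrArg (show ↥(symPiece A M n) →ₗ[A] A from u) (symProj_same s)

theorem DualPiece.extend_restrict {n : ℕ} {f : WithConv (SymmetricAlgebra A M →ₗ[A] A)}
    (hf : ∀ m, m ≠ n → ∀ s ∈ symPiece A M m, f s = 0) : (DualPiece.restrict n f).extend = f := by
  refine WithConv.ext (symPiece_hom_ext fun m s hs => ?_)
  change f (symProj A M n s) = f s
  by_cases h : m = n
  · subst h
    rw [symProj_same ⟨s, hs⟩]
  · rw [symProj_of_ne h hs, hf m h s hs]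
    exact map_zero f.ofConv

theorem DualPiece.extend_of_ne {n m : ℕ} (u : DualPiece A M n) (h : m ≠ n)
    {s : SymmetricAlgebra A M} (hs : s ∈ symPiece A M m) : u.extend s = 0 := by
  change (show ↥(symPiece A M n) →ₗ[A] A from u) (symProj A M n s) = 0
  rw [symProj_of_ne h hs, map_zero]

/-- The convolution product of forms of degree `i` and `j` is of degree `i + j`; degrees are
integers here to have an induction without case distinctions. -/
theorem convMul_homogeneous {m : ℕ} {s : SymmetricAlgebra A M} (hs : s ∈ symPiece A M m) :
    ∀ (i j : ℤ) (f g : SymmetricAlgebra A M →ₗ[A] A),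
      (∀ l : ℕ, (l : ℤ) ≠ i → ∀ t ∈ symPiece A M l, f t = 0) →
      (∀ l : ℕ, (l : ℤ) ≠ j → ∀ t ∈ symPiece A M l, g t = 0) → (m : ℤ) ≠ i + j →
      LinearMap.mul' A A (TensorProduct.map f g (Coalgebra.comul (R := A) s)) = 0 := by
  have hshift : ∀ (x : M) (i : ℤ) (f : SymmetricAlgebra A M →ₗ[A] A),
      (∀ l : ℕ, (l : ℤ) ≠ i → ∀ t ∈ symPiece A M l, f t = 0) →
      ∀ l : ℕ, (l : ℤ) ≠ i - 1 → ∀ t ∈ symPiece A M l,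
        (f ∘ₗ LinearMap.mulLeft A (SymmetricAlgebra.ι A M x)) t = 0 := by
    intro x i f hf l hl t ht
    refine hf (l + 1) (by push_cast; omega) _ ?_
    rw [symPiece, pow_succ']
    exact Submodule.mul_mem_mul ⟨x, rfl⟩ ht
  induction hs using Submodule.pow_induction_on_left' with
  | algebraMap r =>
    intro i j f g hf hg hij
    rw [Algebra.algebraMap_eq_smul_one, map_smul, Bialgebra.comul_one,
      Algebra.TensorProduct.one_def, map_smul, map_smul, TensorProduct.map_tmul,
      LinearMap.mul'_apply]
    have h1 : (1 : SymmetricAlgebra A M) ∈ symPiece A M 0 := by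
      rw [symPiece, pow_zero]; exact Submodule.one_le.1 le_rfl
    by_cases h : ((0 : ℕ) : ℤ) = i
    · rw [hg 0 (by omega) 1 h1, mul_zero, smul_zero]
    · rw [hf 0 h 1 h1, zero_mul, smul_zero]
  | add x y l hx hy ihx ihy =>
    intro i j f g hf hg hij
    rw [map_add, map_add, map_add, ihx i j f g hf hg hij, ihy i j f g hf hg hij, add_zero]
  | mem_mul x hx l t ht ih =>
    obtain ⟨x, rfl⟩ := hx
    intro i j f g hf hg hij
    rw [Bialgebra.comul_mul, SymmetricAlgebra.comul_ι, add_mul, map_add, map_add]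
    have e1 : ∀ z : SymmetricAlgebra A M ⊗[A] SymmetricAlgebra A M,
        TensorProduct.map f g ((SymmetricAlgebra.ι A M x ⊗ₜ[A] 1) * z) =
        TensorProduct.map (f ∘ₗ LinearMap.mulLeft A (SymmetricAlgebra.ι A M x)) g z := by
      intro z
      induction z using TensorProduct.induction_on with
      | zero => simp
      | tmul a b => simp
      | add a b ha hb => rw [mul_add, map_add, map_add, ha, hb]
    have e2 : ∀ z : SymmetricAlgebra A M ⊗[A] SymmetricAlgebra A M,
        TensorProduct.map f g ((1 ⊗ₜ[A] SymmetricAlgebra.ι A M x) * z) =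
        TensorProduct.map f (g ∘ₗ LinearMap.mulLeft A (SymmetricAlgebra.ι A M x)) z := by
      intro z
      induction z using TensorProduct.induction_on with
      | zero => simp
      | tmul a b => simp
      | add a b ha hb => rw [mul_add, map_add, map_add, ha, hb]
    rw [e1, e2, ih (i - 1) j _ g (hshift x i f hf) hg (by push_cast at hij; omega),
      ih i (j - 1) f _ hf (hshift x j g hg) (by push_cast at hij; omega), add_zero]

/-- The shuffle product `(Sym^i M)^* × (Sym^j M)^* → (Sym^(i + j) M)^*`. -/
instance DualPiece.gMul : GradedMonoid.GMul (DualPiece A M) where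
  mul {i j} u v := DualPiece.restrict (i + j) (u.extend * v.extend)

/-- The unit `1 ∈ A = (Sym^0 M)^*`. -/
instance DualPiece.gOne : GradedMonoid.GOne (DualPiece A M) where
  one := DualPiece.restrict 0 1

theorem DualPiece.extend_mul {i j : ℕ} (u : DualPiece A M i) (v : DualPiece A M j) :
    (GradedMonoid.GMul.mul u v).extend = u.extend * v.extend := by
  refine DualPiece.extend_restrict fun m hm s hs => ?_
  refine convMul_homogeneous hs i j u.extend.ofConv v.extend.ofConv ?_ ?_ (by exact_mod_cast hm)
  · exact fun l hl t ht => u.extend_of_ne (by exact_mod_cast hl) ht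
  · exact fun l hl t ht => v.extend_of_ne (by exact_mod_cast hl) ht

theorem DualPiece.extend_one :
    (GradedMonoid.GOne.one : DualPiece A M 0).extend = 1 := by
  refine DualPiece.extend_restrict fun m hm s hs => ?_
  obtain ⟨m, rfl⟩ := Nat.exists_eq_succ_of_ne_zero hm
  rw [LinearMap.convOne_apply, symPiece, pow_succ'] at *
  have : Coalgebra.counit (R := A) s = 0 := by
    induction hs using Submodule.mul_induction_on' with
    | mem_mul_mem x hx y hy =>
      obtain ⟨x, rfl⟩ := hx
      rw [Bialgebra.counit_mul, SymmetricAlgebra.counit_ι, zero_mul]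
    | add x _ y _ hx hy => rw [map_add, hx, hy, add_zero]
  rw [this, map_zero]

theorem DualPiece.extend_add {n : ℕ} (u v : DualPiece A M n) :
    (u + v).extend = u.extend + v.extend := rfl

theorem DualPiece.extend_zero {n : ℕ} : (0 : DualPiece A M n).extend = 0 := rfl

theorem DualPiece.extend_smul {n : ℕ} (a : A) (u : DualPiece A M n) :
    (a • u).extend = a • u.extend := rfl

theorem DualPiece.extend_injective {n : ℕ} :
    Function.Injective (DualPiece.extend (A := A) (M := M) (n := n)) := fun u v h => by
  rw [← u.restrict_extend, h, v.restrict_extend]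

theorem DualPiece.sigma_ext {i j : ℕ} (h : i = j) {u : DualPiece A M i} {v : DualPiece A M j}
    (huv : u.extend = v.extend) : (⟨i, u⟩ : GradedMonoid (DualPiece A M)) = ⟨j, v⟩ := by
  subst h
  rw [DualPiece.extend_injective huv]

instance DualPiece.gCommRing : DirectSum.GCommRing (DualPiece A M) where
  mul_zero u := DualPiece.extend_injective (by rw [extend_mul, extend_zero, mul_zero]; rfl)
  zero_mul u := DualPiece.extend_injective (by rw [extend_mul, extend_zero, zero_mul]; rfl)
  mul_add u v w := DualPiece.extend_injective (by
    rw [extend_mul, extend_add, extend_add, extend_mul, extend_mul, mul_add])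
  add_mul u v w := DualPiece.extend_injective (by
    rw [extend_mul, extend_add, extend_add, extend_mul, extend_mul, add_mul])
  one_mul := by
    rintro ⟨i, u⟩
    exact DualPiece.sigma_ext (zero_add i)
      ((extend_mul GradedMonoid.GOne.one u).trans (by rw [extend_one, one_mul]))
  mul_one := by
    rintro ⟨i, u⟩
    exact DualPiece.sigma_ext (add_zero i)
      ((extend_mul u GradedMonoid.GOne.one).trans (by rw [extend_one, mul_one]))
  mul_assoc := by
    rintro ⟨i, u⟩ ⟨j, v⟩ ⟨l, w⟩
    exact DualPiece.sigma_ext (add_assoc i j l)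
      ((extend_mul (GradedMonoid.GMul.mul u v) w).trans
        ((by rw [extend_mul, extend_mul, mul_assoc] :
          (GradedMonoid.GMul.mul u v).extend * w.extend =
            u.extend * (GradedMonoid.GMul.mul v w).extend).trans
          (extend_mul u (GradedMonoid.GMul.mul v w)).symm))
  mul_comm := by
    rintro ⟨i, u⟩ ⟨j, v⟩
    exact DualPiece.sigma_ext (add_comm i j) (by rw [extend_mul, extend_mul, mul_comm])
  natCast n := n • (GradedMonoid.GOne.one : DualPiece A M 0)
  natCast_zero := zero_smul _ _
  natCast_succ n := succ_nsmul _ _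
  intCast n := n • (GradedMonoid.GOne.one : DualPiece A M 0)
  intCast_ofNat n := natCast_zsmul _ _
  intCast_negSucc_ofNat n := negSucc_zsmul _ _

instance DualPiece.gAlgebra : DirectSum.GAlgebra A (DualPiece A M) where
  toFun := (LinearMap.toSpanSingleton A (DualPiece A M 0) GradedMonoid.GOne.one).toAddMonoidHom
  map_one := one_smul A _
  map_mul r s := by
    refine DualPiece.sigma_ext (zero_add 0).symm ?_
    rw [extend_mul]
    change ((r * s) • (GradedMonoid.GOne.one : DualPiece A M 0)).extend =
      (r • (GradedMonoid.GOne.one : DualPiece A M 0)).extend *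
        (s • (GradedMonoid.GOne.one : DualPiece A M 0)).extend
    rw [extend_smul, extend_smul, extend_smul, extend_one, smul_mul_smul_comm, one_mul]
  commutes r := by
    rintro ⟨i, u⟩
    exact DualPiece.sigma_ext (add_comm 0 i)
      ((extend_mul (r • (GradedMonoid.GOne.one : DualPiece A M 0)) u).trans
        ((mul_comm _ _).trans (extend_mul u (r • (GradedMonoid.GOne.one : DualPiece A M 0))).symm))
  smul_def r := by
    rintro ⟨i, u⟩
    refine DualPiece.sigma_ext (zero_add i).symm
      (Eq.trans ?_ (extend_mul (r • (GradedMonoid.GOne.one : DualPiece A M 0)) u).symm)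
    change (r • u).extend = _
    rw [extend_smul, extend_smul, extend_one, smul_mul_assoc, one_mul]

end GradedDual

section Theta

variable (k A : Type*) [CommRing k] [CommRing A] [Algebra k A]

/-- The powers `I^n` of the kernel `I` of the multiplication `P_{A/k} = A ⊗[k] A → A`, as modules
over `A` acting on the left factor. -/
def diagPow (n : ℕ) : Submodule A (A ⊗[k] A) :=
  (KaehlerDifferential.ideal k A ^ n).restrictScalars A

/-- The powers `I^(n + 1)`. -/
def diagPowSucc (n : ℕ) : Submodule A (A ⊗[k] A) := diagPow k A (n + 1)

instance diagPow_isGrPair : IsGrPair (diagPow k A) (diagPowSucc k A) where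
  one_mem := by
    change (1 : A ⊗[k] A) ∈ KaehlerDifferential.ideal k A ^ 0
    rw [pow_zero, Ideal.one_eq_top]
    trivial
  mul_mem {i j x y} hx hy := by
    change x * y ∈ KaehlerDifferential.ideal k A ^ (i + j)
    rw [pow_add]
    exact Ideal.mul_mem_mul hx hy
  mul_mem_left {i j x y} hx hy := by
    change x * y ∈ KaehlerDifferential.ideal k A ^ (i + j + 1)
    rw [add_assoc, pow_add]
    exact Ideal.mul_mem_mul hx hy
  mul_mem_right {i j x y} hx hy := by
    change x * y ∈ KaehlerDifferential.ideal k A ^ (i + j + 1)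
    rw [add_right_comm, pow_add]
    exact Ideal.mul_mem_mul hx hy
  comm_mem {i j x y} hx hy := by
    rw [mul_comm x y, sub_self]
    exact zero_mem _

/-- The commutative graded `A`-algebra `gr_I P_{A/k} = ⨁ n, I^n / I^(n + 1)`. -/
abbrev GrPrincipal : Type _ := ⨁ n, GrPiece (diagPow k A) (diagPowSucc k A) n

variable {A} in
theorem diag_mem (a : A) : (1 : A) ⊗ₜ[k] a - a ⊗ₜ[k] (1 : A) ∈ diagPow k A 1 := by
  change _ ∈ KaehlerDifferential.ideal k A ^ 1
  rw [pow_one]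
  exact KaehlerDifferential.one_smul_sub_smul_one_mem_ideal k a

/-- The `k`-derivation `A → I / I^2`, `a ↦ 1 ⊗ a - a ⊗ 1`. -/
def diagDer : Derivation k A (GrPiece (diagPow k A) (diagPowSucc k A) 1) :=
  Derivation.mk'
    { toFun := fun a => GrPiece.mk (diagPow k A) (diagPowSucc k A) 1
        ⟨(1 : A) ⊗ₜ[k] a - a ⊗ₜ[k] (1 : A), diag_mem k a⟩
      map_add' := fun a b => by
        rw [← map_add, GrPiece.mk_eq_mk]
        convert zero_mem (diagPowSucc k A 1) using 1
        simp only [Submodule.coe_add, TensorProduct.tmul_add, TensorProduct.add_tmul]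
        abel
      map_smul' := fun c a => by
        rw [RingHom.id_apply, ← algebraMap_smul A c (GrPiece.mk (diagPow k A) (diagPowSucc k A) 1 _),
          ← map_smul, GrPiece.mk_eq_mk]
        convert zero_mem (diagPowSucc k A 1) using 1
        simp only [Submodule.coe_smul_of_tower, algebraMap_smul, smul_sub, TensorProduct.tmul_smul,
          TensorProduct.smul_tmul', sub_self] }
    (fun a b => by
      change GrPiece.mk (diagPow k A) (diagPowSucc k A) 1 _ =
        a • GrPiece.mk (diagPow k A) (diagPowSucc k A) 1 _ +
        b • GrPiece.mk (diagPow k A) (diagPowSucc k A) 1 _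
      rw [← map_smul, ← map_smul, ← map_add, GrPiece.mk_eq_mk]
      have h : ((1 : A) ⊗ₜ[k] a - a ⊗ₜ[k] (1 : A)) * ((1 : A) ⊗ₜ[k] b - b ⊗ₜ[k] (1 : A)) ∈
          diagPowSucc k A 1 :=
        IsGrPair.mul_mem (G := diagPowSucc k A) (diag_mem k a) (diag_mem k b)
      convert h using 1
      simp only [Submodule.coe_add, Submodule.coe_smul, smul_sub, TensorProduct.smul_tmul',
        smul_eq_mul, mul_one, sub_mul, mul_sub, Algebra.TensorProduct.tmul_mul_tmul, one_mul]
      rw [mul_comm b a]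
      abel)

/-- The canonical homomorphism of graded `A`-algebras `υ : Sym Ω_{A/k} → gr_I P_{A/k}`, which is
the identification `Ω_{A/k} = I / I^2`, `da ↦ 1 ⊗ a - a ⊗ 1`, in degree one. -/
def upsilon : SymmetricAlgebra A Ω[A⁄k] →ₐ[A] GrPrincipal k A :=
  SymmetricAlgebra.lift
    (DirectSum.lof A ℕ (GrPiece (diagPow k A) (diagPowSucc k A)) 1 ∘ₗ
      (diagDer k A).liftKaehlerDifferential)

variable {k A}

/-- The left `A`-linear map `A ⊗[k] A → A`, `a ⊗ b ↦ a P(b)`, as a function of `P`. -/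
def linearize : Module.End k A →ₗ[A] (A ⊗[k] A →ₗ[A] A) where
  toFun P := LinearMap.liftBaseChange A P
  map_add' P Q := by ext; simp
  map_smul' a P := by ext; simp

theorem linearize_tmul (P : Module.End k A) (a b : A) : linearize P (a ⊗ₜ[k] b) = a * P b := by
  simp [linearize]

/-- A differential operator of order `≤ n - 1` factors through `P_{A/k} / I^n`. -/
theorem linearize_eq_zero {n : ℕ} {P : Module.End k A} (hP : P ∈ diffOpPred k A n)
    {z : A ⊗[k] A} (hz : z ∈ KaehlerDifferential.ideal k A ^ n) : linearize P z = 0 := by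
  have step : ∀ (P : Module.End k A) (a : A) (z : A ⊗[k] A),
      linearize P (((1 : A) ⊗ₜ[k] a - a ⊗ₜ[k] (1 : A)) * z) = linearize (bracket k a P) z := by
    intro P a z
    induction z using TensorProduct.induction_on with
    | zero => simp
    | tmul x y =>
      rw [sub_mul, map_sub, Algebra.TensorProduct.tmul_mul_tmul,
        Algebra.TensorProduct.tmul_mul_tmul, linearize_tmul, linearize_tmul, linearize_tmul,
        bracket_apply, one_mul, one_mul]
      ring
    | add x y hx hy => rw [mul_add, map_add, map_add, hx, hy]
  induction n generalizing P z with
  | zero =>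
    rw [(Submodule.mem_bot A).1 hP, map_zero, LinearMap.zero_apply]
  | succ n ih =>
    rw [mem_diffOpPred_succ] at hP
    rw [pow_succ'] at hz
    induction hz using Submodule.mul_induction_on' with
    | add x _ y _ hx hy => rw [map_add, hx, hy, add_zero]
    | mem_mul_mem x hx y hy =>
      rw [← KaehlerDifferential.span_range_eq_ideal] at hx
      induction hx using Submodule.span_induction generalizing y with
      | mem x hx =>
        obtain ⟨a, rfl⟩ := hx
        rw [step]
        exact ih (hP a) hy
      | zero => rw [zero_mul, map_zero]
      | add x x' _ _ h h' => rw [add_mul, map_add, h y hy, h' y hy, add_zero]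
      | smul c x _ h =>
        rw [smul_mul_assoc, smul_eq_mul, mul_left_comm]
        exact h (c * y) (Ideal.mul_mem_left _ _ hy)

variable (k A)

/-- `λ_n : gr^n D_{A/k} → Hom_A(I^n / I^(n + 1), A)`, which sends the class of `P` to the map
induced by `a ⊗ b ↦ a P(b)`. -/
def lambda (n : ℕ) :
    GrDiffPiece k A n →ₗ[A] (GrPiece (diagPow k A) (diagPowSucc k A) n →ₗ[A] A) :=
  GrPiece.lift
    { toFun := fun P =>
        GrPiece.lift ((linearize (P : Module.End k A)).comp (diagPow k A n).subtype)
          fun z hz => linearize_eq_zero (n := n + 1) P.2 hz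
      map_add' := fun P Q => by
        refine LinearMap.ext fun z => ?_
        obtain ⟨z, rfl⟩ := GrPiece.mk_surjective n z
        exact congrArg (fun f => f (z : A ⊗[k] A)) (linearize.map_add (P : Module.End k A) Q)
      map_smul' := fun a P => by
        refine LinearMap.ext fun z => ?_
        obtain ⟨z, rfl⟩ := GrPiece.mk_surjective n z
        exact congrArg (fun f => f (z : A ⊗[k] A)) (linearize.map_smul a (P : Module.End k A)) }
    (fun P hP => by
      refine LinearMap.ext fun z => ?_
      obtain ⟨z, rfl⟩ := GrPiece.mk_surjective n z
      exact linearize_eq_zero hP z.2)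

/-- `θ_n : gr^n D_{A/k} → (Sym^n Ω_{A/k})^*`, the composition of `λ_n` with the transpose of
`υ_n : Sym^n Ω_{A/k} → I^n / I^(n + 1)`. -/
def thetaPiece (n : ℕ) : GrDiffPiece k A n →ₗ[A] DualPiece A Ω[A⁄k] n :=
  LinearMap.comp
    (LinearMap.lcomp A A
      (DirectSum.component A ℕ (GrPiece (diagPow k A) (diagPowSucc k A)) n ∘ₗ
        (upsilon k A).toLinearMap ∘ₗ (symPiece A Ω[A⁄k] n).subtype))
    (lambda k A n)

/-- `θ_{A/k} = ⨁ n, θ_n : gr D_{A/k} → (Sym Ω_{A/k})^*_gr`. -/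
def theta : GrDiff k A →ₗ[A] GradedDual A Ω[A⁄k] :=
  DirectSum.lmap (thetaPiece k A)

end Theta

end HSInt
end

/-! Write `M` for `Ω[A⁄k]`, so that `M^* = Der_k(A)`. A form on `Sym M` is controlled by its value
at `1` and its contractions `t ↦ u(x t)` with `x ∈ M`, which behave like partial derivatives.
Contraction is a derivation of the convolution product, it lowers the divided power `f^{[n+1]}` of a
linear form to `f(x) f^{[n]}`, and on the form `θ(σ(P))` contraction by `da` is the bracket `[P, a]`
(`contract_thetaForm_succ`). Hence induction on the order shows, with no hypothesis on `A`, that `θ`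
is an injective algebra homomorphism (`theta_injective`, `thetaForm_mul`) and that `θ ∘ ϑ` sends
`γ_n(δ)` to the `n`-th divided power of the linear form of `δ` (`extendHom_theta_vartheta`).

If every derivation is integrable, `θ ∘ ϑ` is therefore the canonical map `Γ(M^*) → (Sym M)^*_gr`.
This map is bijective when `M^*` is finitely generated projective (`dpHom_injective`,
`mem_range_dpHom`). The module `M` itself need be neither finite nor projective, so forms on `Sym M`
are first extended to the bidual of `M` and then read in coordinates from a finite dual basis of
`M^*`. Both `θ` and `ϑ` are then bijective.

Conversely, let `θ` be surjective. The obstruction to prolonging a Hasse–Schmidt derivation by one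
step is a symmetric Hochschild 2-cocycle `E` whose values `E a = E(a, ·)` are differential
operators. The symbols of the `E a` form a closed family of partial derivatives, which has a
potential on `Sym M`; surjectivity of `θ` realizes it by an operator `Q`, whose coboundary cancels
the top order of `E`. Descending on the order, `E` is a coboundary (`exists_coboundary`), so every
derivation integrates. If instead `ϑ` is surjective, it suffices to look at degree one, where its
image contains only symbols of integrable derivations. -/

noncomputable section

open scoped TensorProduct DirectSum

namespace HSInt

/-! ### Forms on symmetric algebras: contractions and divided powers -/

section SymmetricForms

open SymmetricAlgebra WithConv

variable {A M : Type*} [CommRing A] [AddCommGroup M] [Module A M]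

/-- Lift of a linear map with commuting values in a not necessarily commutative algebra to the
symmetric algebra. -/
def symLift {B : Type*} [Ring B] [Algebra A B] (f : M →ₗ[A] B)
    (h : ∀ x y, f x * f y = f y * f x) : SymmetricAlgebra A M →ₐ[A] B :=
  RingCon.liftₐ _ (TensorAlgebra.lift A f) <| by
    refine RingCon.ringConGen_le.2 fun x y h' => ?_
    induction h' with | mul_comm x y
    rw [RingCon.ker_apply]
    simp [h x y]

theorem symLift_ι {B : Type*} [Ring B] [Algebra A B] (f : M →ₗ[A] B)
    (h : ∀ x y, f x * f y = f y * f x) (x : M) : symLift f h (ι A M x) = f x :=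
  TensorAlgebra.lift_ι_apply f x

/-- Induction on elements of a symmetric algebra, one linear factor at a time. -/
theorem sym_induction {P : SymmetricAlgebra A M → Prop} (one : P 1)
    (add : ∀ s t, P s → P t → P (s + t)) (smul : ∀ (a : A) t, P t → P (a • t))
    (ι_mul : ∀ (x : M) t, P t → P (ι A M x * t)) (t : SymmetricAlgebra A M) : P t := by
  -- The claim that multiplication by `s` preserves `P` is stable under products in `s`, unlike `P`
  -- itself.
  suffices h : ∀ s t : SymmetricAlgebra A M, P t → P (s * t) by simpa using h t 1 one
  intro s
  induction s using SymmetricAlgebra.induction with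
  | algebraMap r => intro t ht; rw [← Algebra.smul_def]; exact smul r t ht
  | ι x => exact fun t ht => ι_mul x t ht
  | mul a b ha hb => intro t ht; rw [mul_assoc]; exact ha _ (hb t ht)
  | add a b ha hb => intro t ht; rw [add_mul]; exact add _ _ (ha t ht) (hb t ht)

variable (A M) in
/-- The full dual of `Sym M`, with the convolution product. -/
abbrev SymDual : Type _ := WithConv (SymmetricAlgebra A M →ₗ[A] A)

/-- The linear form `x ↦ u (x t)` on `M`. -/
def slice (u : SymDual A M) : SymmetricAlgebra A M →ₗ[A] Module.Dual A M where
  toFun t := u.ofConv ∘ₗ LinearMap.mulRight A t ∘ₗ ι A M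
  map_add' s t := by ext x; simp [mul_add]
  map_smul' a t := by ext x; simp

theorem slice_apply (u : SymDual A M) (t : SymmetricAlgebra A M) (x : M) :
    slice u t x = u (ι A M x * t) := rfl

/-- Contraction of a form on `Sym M` with an element of the bidual of `M`. -/
def contract (c : Module.Dual A (Module.Dual A M)) : SymDual A M →ₗ[A] SymDual A M where
  toFun u := toConv (c ∘ₗ slice u)
  map_add' u v := by
    ext t
    exact c.map_add (slice u t) (slice v t)
  map_smul' a u := by
    ext t
    exact c.map_smul a (slice u t)

theorem contract_apply (c : Module.Dual A (Module.Dual A M)) (u : SymDual A M)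
    (t : SymmetricAlgebra A M) : contract c u t = c (slice u t) := rfl

theorem contract_eval_apply (x : M) (u : SymDual A M) (t : SymmetricAlgebra A M) :
    contract (Module.Dual.eval A M x) u t = u (ι A M x * t) := rfl

theorem symDual_ext {u v : SymDual A M} (h1 : u 1 = v 1)
    (h : ∀ x t, u (ι A M x * t) = v (ι A M x * t)) : u = v := by
  ext t
  induction t using sym_induction with
  | one => exact h1
  | add s t hs ht => rw [map_add, map_add, hs, ht]
  | smul a t ht => rw [map_smul, map_smul, ht]
  | ι_mul x t ht => exact h x t

/-- The principle behind most identities between forms: compare constant terms, contract, and use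
induction on the degree. -/
theorem symDual_ext_contract {u v : SymDual A M} (h1 : u 1 = v 1)
    (h : ∀ x, contract (Module.Dual.eval A M x) u = contract (Module.Dual.eval A M x) v) :
    u = v :=
  symDual_ext h1 fun x t => by rw [← contract_eval_apply, h, contract_eval_apply]

theorem symDual_mul_one_apply (u v : SymDual A M) : (u * v) 1 = u 1 * v 1 := by
  rw [LinearMap.convMul_apply, Bialgebra.comul_one, Algebra.TensorProduct.one_def,
    TensorProduct.map_tmul, LinearMap.mul'_apply]

theorem symDual_mul_ι_mul (u v : SymDual A M) (x : M) {t : SymmetricAlgebra A M} {κ : Type*}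
    (r : Coalgebra.Repr A t κ) :
    (u * v) (ι A M x * t) = ∑ i ∈ r.index, (u (ι A M x * r.left i) * v (r.right i) +
      u (r.left i) * v (ι A M x * r.right i)) := by
  rw [LinearMap.convMul_apply, Bialgebra.comul_mul, SymmetricAlgebra.comul_ι, ← r.eq]
  simp [Finset.mul_sum, add_mul]

/-- The Leibniz rule, which reflects that the elements of `M` are primitive for the
comultiplication. It is needed for every `c` in the bidual, not only for evaluations at elements of
`M`, so it is checked on slices, to which `c` is then applied. -/
theorem contract_mul (c : Module.Dual A (Module.Dual A M)) (u v : SymDual A M) :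
    contract c (u * v) = contract c u * v + u * contract c v := by
  ext t
  let r := Coalgebra.Repr.arbitrary A t
  have h : slice (u * v) t = ∑ i ∈ r.index, (v (r.right i) • slice u (r.left i) +
      u (r.left i) • slice v (r.right i)) := by
    ext x
    rw [slice_apply, symDual_mul_ι_mul u v x r, LinearMap.sum_apply]
    refine Finset.sum_congr rfl fun i _ => ?_
    simp [slice_apply, mul_comm]
  change contract c (u * v) t = (contract c u * v) t + (u * contract c v) t
  rw [contract_apply, h, r.convMul_apply, r.convMul_apply, ← Finset.sum_add_distrib, map_sum]
  refine Finset.sum_congr rfl fun i _ => ?_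
  simp [contract_apply, mul_comm]

theorem contract_one (c : Module.Dual A (Module.Dual A M)) : contract c (1 : SymDual A M) = 0 := by
  ext t
  have h : slice (1 : SymDual A M) t = 0 := by
    ext x
    rw [slice_apply, LinearMap.convOne_apply, Bialgebra.counit_mul, SymmetricAlgebra.counit_ι]
    simp
  change contract c 1 t = 0
  rw [contract_apply, h, map_zero]

theorem symDual_one_one : (1 : SymDual A M) 1 = 1 := by
  rw [LinearMap.convOne_apply, Bialgebra.counit_one, map_one]

/-- The homomorphism `Sym M → A[X]` that sends `x ∈ M` to `f(x) X`. -/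
def evalPoly (f : Module.Dual A M) : SymmetricAlgebra A M →ₐ[A] Polynomial A :=
  SymmetricAlgebra.lift (f.smulRight Polynomial.X)

/-- The divided power of degree `n` of a linear form `f`: the form on `Sym M` that vanishes
outside of degree `n` and sends `x₁ ⋯ xₙ` to `f(x₁) ⋯ f(xₙ)`. -/
def dpForm (n : ℕ) (f : Module.Dual A M) : SymDual A M :=
  toConv (Polynomial.lcoeff A n ∘ₗ (evalPoly f).toLinearMap)

theorem dpForm_apply (n : ℕ) (f : Module.Dual A M) (t : SymmetricAlgebra A M) :
    dpForm n f t = (evalPoly f t).coeff n := rfl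

theorem dpForm_succ_one (n : ℕ) (f : Module.Dual A M) : dpForm (n + 1) f 1 = 0 := by
  rw [dpForm_apply, map_one, Polynomial.coeff_one, if_neg (by omega)]

theorem dpForm_ι_mul (n : ℕ) (f : Module.Dual A M) (x : M) (t : SymmetricAlgebra A M) :
    dpForm (n + 1) f (ι A M x * t) = f x * dpForm n f t := by
  rw [dpForm_apply, map_mul, evalPoly, SymmetricAlgebra.lift_ι_apply, LinearMap.smulRight_apply,
    smul_mul_assoc, Polynomial.coeff_smul, Polynomial.coeff_X_mul]
  rfl

theorem dpForm_zero (f : Module.Dual A M) : dpForm 0 f = 1 := by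
  refine symDual_ext ?_ fun x t => ?_
  · rw [symDual_one_one, dpForm_apply, map_one, Polynomial.coeff_one_zero]
  · rw [LinearMap.convOne_apply, Bialgebra.counit_mul, SymmetricAlgebra.counit_ι, zero_mul,
      map_zero, dpForm_apply, map_mul, evalPoly, SymmetricAlgebra.lift_ι_apply]
    simp

/-- The rule `∂_c f^{[n+1]} = c(f) f^{[n]}`. With the constant terms, it characterizes the divided
powers of `f` and yields the divided power relations below. -/
theorem contract_dpForm_succ (c : Module.Dual A (Module.Dual A M)) (n : ℕ)
    (f : Module.Dual A M) : contract c (dpForm (n + 1) f) = c f • dpForm n f := by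
  ext t
  have h : slice (dpForm (n + 1) f) t = dpForm n f t • f := by
    ext x
    rw [slice_apply, dpForm_ι_mul, LinearMap.smul_apply, smul_eq_mul, mul_comm]
  change contract c (dpForm (n + 1) f) t = c f • dpForm n f t
  rw [contract_apply, h, map_smul, smul_eq_mul, smul_eq_mul, mul_comm]

theorem dpForm_smul (n : ℕ) (a : A) (f : Module.Dual A M) :
    dpForm n (a • f) = a ^ n • dpForm n f := by
  induction n with
  | zero => rw [dpForm_zero, dpForm_zero, pow_zero, one_smul]
  | succ n ih =>
    refine symDual_ext_contract ?_ fun x => ?_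
    · change _ = a ^ (n + 1) • dpForm (n + 1) f 1
      rw [dpForm_succ_one, dpForm_succ_one, smul_zero]
    · rw [map_smul, contract_dpForm_succ, contract_dpForm_succ, ih, map_smul, smul_eq_mul,
        smul_smul, smul_smul]
      ring_nf

theorem symDual_sum_apply {κ : Type*} (s : Finset κ) (u : κ → SymDual A M)
    (t : SymmetricAlgebra A M) : (∑ i ∈ s, u i) t = ∑ i ∈ s, u i t := by
  classical
  induction s using Finset.induction_on with
  | empty => rfl
  | insert i s hi ih =>
    rw [Finset.sum_insert hi, Finset.sum_insert hi, ← ih]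
    rfl

/-- Contraction turns the identity into two instances of lower total degree, whose coefficients add
up by Pascal's rule. -/
theorem dpForm_mul (n p : ℕ) (f : Module.Dual A M) :
    dpForm n f * dpForm p f = (n + p).choose n • dpForm (n + p) f := by
  induction hs : n + p generalizing n p with
  | zero =>
    obtain ⟨rfl, rfl⟩ : n = 0 ∧ p = 0 := by omega
    simp [dpForm_zero]
  | succ s ih =>
    rcases n with _ | n
    · obtain rfl : p = s + 1 := by omega
      simp [dpForm_zero]
    rcases p with _ | p
    · obtain rfl : n = s := by omega
      simp [dpForm_zero]
    refine symDual_ext_contract ?_ fun x => ?_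
    · rw [symDual_mul_one_apply, dpForm_succ_one, zero_mul]
      change _ = ((s + 1).choose (n + 1)) • dpForm (s + 1) f 1
      rw [dpForm_succ_one, smul_zero]
    · rw [contract_mul, map_nsmul, contract_dpForm_succ, contract_dpForm_succ,
        contract_dpForm_succ, smul_mul_assoc, mul_smul_comm, ih n (p + 1) (by omega),
        ih (n + 1) p (by omega), Nat.choose_succ_succ, add_smul]
      simp only [smul_comm _ (Module.Dual.eval A M x f)]

theorem dpForm_add (n : ℕ) (f g : Module.Dual A M) :
    dpForm n (f + g) =
      ∑ p ∈ Finset.HasAntidiagonal.antidiagonal n, dpForm p.1 f * dpForm p.2 g := by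
  induction n with
  | zero => simp [dpForm_zero]
  | succ n ih =>
    refine symDual_ext_contract ?_ fun x => ?_
    · rw [dpForm_succ_one, symDual_sum_apply, Finset.sum_eq_zero]
      rintro ⟨i, j⟩ h
      have := Finset.HasAntidiagonal.mem_antidiagonal.1 h
      rw [symDual_mul_one_apply]
      rcases i with _ | i
      · obtain rfl : j = n + 1 := by simpa using this
        rw [dpForm_succ_one, mul_zero]
      · rw [dpForm_succ_one, zero_mul]
    · rw [map_sum, contract_dpForm_succ, ih]
      simp only [contract_mul, Finset.sum_add_distrib]
      -- The Leibniz rule gives two sums. From each, the end of the antidiagonal where the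
      -- contracted factor is `f^{[0]} = 1` or `g^{[0]} = 1` is split off; it contributes zero.
      conv_rhs =>
        congr
        · rw [Finset.Nat.antidiagonal_succ]
        · rw [Finset.Nat.antidiagonal_succ']
      simp only [Finset.sum_cons, Finset.sum_map, dpForm_zero, contract_one, zero_mul, mul_zero,
        zero_add, Function.Embedding.prodMap, Function.Embedding.coeFn_mk, Prod.map,
        Function.Embedding.refl_apply, Nat.succ_eq_add_one, contract_dpForm_succ, smul_mul_assoc,
        mul_smul_comm, ← Finset.smul_sum, ← add_smul, map_add]

variable {N : Type*} [AddCommGroup N] [Module A N]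

/-- The homomorphism `Γ N → (Sym M)^*` that sends `γ_n(y)` to the divided power of degree `n` of
the linear form `j y`. -/
def dpHom (j : N →ₗ[A] Module.Dual A M) : DividedPowerAlgebra A N →ₐ[A] SymDual A M :=
  DividedPowerAlgebra.lift' (f := fun p : ℕ × N => dpForm p.1 (j p.2))
    (fun y => dpForm_zero _) (fun n a y => by simp only [map_smul, dpForm_smul])
    (fun n p y => dpForm_mul n p _) (fun n y z => by simp only [map_add, dpForm_add])

theorem dpHom_dp (j : N →ₗ[A] Module.Dual A M) (n : ℕ) (y : N) :
    dpHom j (DividedPowerAlgebra.dp A n y) = dpForm n (j y) :=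
  DividedPowerAlgebra.lift'_apply_dp _ _ _ _ n y

end SymmetricForms

/-! ### Divided powers of a finitely generated projective dual -/

section DividedPowersOfDual

open SymmetricAlgebra WithConv

variable {A M : Type*} [CommRing A] [AddCommGroup M] [Module A M]

variable (A M) in
/-- The contraction as a linear map. -/
def contractHom : Module.Dual A (Module.Dual A M) →ₗ[A] Module.End A (SymDual A M) where
  toFun c := contract c
  map_add' _ _ := rfl
  map_smul' _ _ := rfl

/-- The two ways of extending a symmetric bilinear form on `M` to the bidual agree. Expanding `B x`
in the dual basis, directly and after exchanging the arguments, gives `e ∘ B = ∑ e(f i) (c i ∘ B)`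
and `d ∘ B = ∑ d(c i ∘ B) f i`, so both sides equal `∑ e(f i) d(c i ∘ B)`. -/
theorem dual_dual_comm {κ : Type*} [Fintype κ] {f : κ → Module.Dual A M}
    {c : κ → Module.Dual A (Module.Dual A M)} (hf : ∀ g, ∑ i, c i g • f i = g)
    {B : M →ₗ[A] Module.Dual A M} (hB : ∀ x y, B x y = B y x)
    (d e : Module.Dual A (Module.Dual A M)) : d (e ∘ₗ B) = e (d ∘ₗ B) := by
  have h1 : e ∘ₗ B = ∑ i, e (f i) • (c i ∘ₗ B) := by
    ext x
    conv_lhs => rw [LinearMap.comp_apply, ← hf (B x), map_sum]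
    simp [mul_comm]
  have h2 : d ∘ₗ B = ∑ i, d (c i ∘ₗ B) • f i := by
    ext x
    have : B x = ∑ i, f i x • (c i ∘ₗ B) := by
      ext y
      rw [hB]
      conv_lhs => rw [← hf (B y)]
      simp [mul_comm]
    rw [LinearMap.comp_apply, this, map_sum]
    simp [mul_comm]
  rw [h1, h2]
  simp [mul_comm]

/-- If the dual of `M` is finitely generated projective, the contractions commute. -/
theorem contract_comm {κ : Type*} [Fintype κ] {f : κ → Module.Dual A M}
    {c : κ → Module.Dual A (Module.Dual A M)} (hf : ∀ g, ∑ i, c i g • f i = g)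
    (d e : Module.Dual A (Module.Dual A M)) (u : SymDual A M) :
    contract d (contract e u) = contract e (contract d u) := by
  ext t
  -- For fixed `t`, the bilinear form `(x, y) ↦ u(y x t)` is symmetric because `Sym M` is
  -- commutative.
  refine dual_dual_comm hf (B := slice u ∘ₗ LinearMap.mulRight A t ∘ₗ ι A M) (fun x y => ?_) d e
  change u (ι A M y * (ι A M x * t)) = u (ι A M x * (ι A M y * t))
  rw [mul_left_comm]

section Pullback

variable {F : Type*} [AddCommGroup F] [Module A F] (e : F →ₗ[A] Module.Dual A (Module.Dual A M))
  (hc : ∀ (c d : Module.Dual A (Module.Dual A M)) (u : SymDual A M),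
    contract c (contract d u) = contract d (contract c u))

/-- The action of `Sym F` on the forms on `Sym M` by iterated contractions. -/
def contractAction : SymmetricAlgebra A F →ₐ[A] Module.End A (SymDual A M) :=
  symLift (B := Module.End A (SymDual A M)) (contractHom A M ∘ₗ e) fun x y =>
    LinearMap.ext fun u => hc (e x) (e y) u

/-- The extension of a form on `Sym M` to the symmetric algebra of the bidual of `M`, pulled back
to `Sym F`. -/
def bidualExtend : SymDual A M →ₗ[A] SymDual A F where
  toFun u := toConv
    { toFun := fun s => contractAction e hc s u 1
      map_add' := fun s t => by rw [map_add]; rfl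
      map_smul' := fun a s => by rw [map_smul]; rfl }
  map_add' u v := by
    ext s
    change (contractAction e hc s (u + v)) 1 =
      (contractAction e hc s u) 1 + (contractAction e hc s v) 1
    rw [map_add]; rfl
  map_smul' a u := by
    ext s
    change (contractAction e hc s (a • u)) 1 = a • (contractAction e hc s u) 1
    rw [map_smul]; rfl

theorem bidualExtend_one_apply (u : SymDual A M) : bidualExtend e hc u 1 = u 1 := by
  change (contractAction e hc 1 u) 1 = u 1
  rw [map_one (contractAction e hc)]; rfl

theorem bidualExtend_ι_mul (u : SymDual A M) (y : F) (s : SymmetricAlgebra A F) :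
    bidualExtend e hc u (ι A F y * s) = bidualExtend e hc (contract (e y) u) s := by
  change (contractAction e hc (ι A F y * s) u) 1 = (contractAction e hc s (contract (e y) u)) 1
  -- After exchanging the factors, the contraction by `e y` acts on `u` before `s` does.
  rw [mul_comm, map_mul, contractAction, symLift_ι]
  rfl

theorem contract_bidualExtend (u : SymDual A M) (y : F) :
    contract (Module.Dual.eval A F y) (bidualExtend e hc u) =
      bidualExtend e hc (contract (e y) u) := by
  ext s
  exact bidualExtend_ι_mul e hc u y s

theorem bidualExtend_one : bidualExtend e hc 1 = 1 := by
  refine symDual_ext_contract ?_ fun y => ?_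
  · rw [bidualExtend_one_apply, symDual_one_one, symDual_one_one]
  · rw [contract_bidualExtend, contract_one, contract_one, map_zero]

/-- On both sides, multiplying the argument by `y` amounts to applying the Leibniz rule for the
contraction by `e y`, so induction on the number of linear factors applies. -/
theorem bidualExtend_mul (u v : SymDual A M) :
    bidualExtend e hc (u * v) = bidualExtend e hc u * bidualExtend e hc v := by
  ext s
  change bidualExtend e hc (u * v) s = (bidualExtend e hc u * bidualExtend e hc v) s
  induction s using sym_induction generalizing u v with
  | one =>
    simp only [symDual_mul_one_apply, bidualExtend_one_apply]
  | add s t hs ht => rw [map_add, map_add, hs, ht]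
  | smul a t ht => rw [map_smul, map_smul, ht]
  | ι_mul y t ht =>
    rw [← contract_eval_apply, ← contract_eval_apply, contract_bidualExtend, contract_mul,
      contract_mul, map_add, contract_bidualExtend, contract_bidualExtend]
    exact congrArg₂ (· + ·) (ht _ _) (ht _ _)

theorem bidualExtend_dpForm (n : ℕ) (g : Module.Dual A M) :
    bidualExtend e hc (dpForm n g) = dpForm n (e.flip g) := by
  induction n with
  | zero => rw [dpForm_zero, dpForm_zero, bidualExtend_one]
  | succ n ih =>
    refine symDual_ext_contract ?_ fun y => ?_
    · rw [bidualExtend_one_apply, dpForm_succ_one, dpForm_succ_one]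
    · rw [contract_bidualExtend, contract_dpForm_succ, contract_dpForm_succ, map_smul, ih]
      rfl

theorem bidualExtend_dpHom {N : Type*} [AddCommGroup N] [Module A N]
    (j : N →ₗ[A] Module.Dual A M) (z : DividedPowerAlgebra A N) :
    bidualExtend e hc (dpHom j z) = dpHom (e.flip ∘ₗ j) z := by
  have : (AlgHom.ofLinearMap (bidualExtend e hc) (bidualExtend_one e hc)
      (bidualExtend_mul e hc)).comp (dpHom j) = dpHom (e.flip ∘ₗ j) := by
    refine DividedPowerAlgebra.algHom_ext fun n y => ?_
    rw [AlgHom.comp_apply, dpHom_dp, dpHom_dp]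
    exact bidualExtend_dpForm e hc n (j y)
  exact DFunLike.congr_fun this z

end Pullback

/-! ### Coordinates: forms as coefficients of polynomials -/

theorem contract_prod {κ : Type*} [DecidableEq κ] (c : Module.Dual A (Module.Dual A M))
    (s : Finset κ) (u : κ → SymDual A M) :
    contract c (∏ i ∈ s, u i) = ∑ i ∈ s, contract c (u i) * ∏ j ∈ s.erase i, u j := by
  induction s using Finset.induction_on with
  | empty => simp [contract_one]
  | insert i s hi ih =>
    rw [Finset.prod_insert hi, contract_mul, ih, Finset.sum_insert hi, Finset.erase_insert hi,
      Finset.mul_sum]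
    congr 1
    refine Finset.sum_congr rfl fun l hl => ?_
    have hli : l ≠ i := fun h => hi (h ▸ hl)
    rw [Finset.erase_insert_of_ne hli.symm, Finset.prod_insert (by simp [hi]), mul_left_comm]

theorem symDual_prod_one_apply {κ : Type*} (s : Finset κ) (u : κ → SymDual A M) :
    (∏ i ∈ s, u i) 1 = ∏ i ∈ s, u i 1 := by
  classical
  induction s using Finset.induction_on with
  | empty => simp only [Finset.prod_empty, symDual_one_one]
  | insert i s hi ih => rw [Finset.prod_insert hi, Finset.prod_insert hi, symDual_mul_one_apply, ih]

variable {κ : Type*} [Fintype κ]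

/-- The homomorphism `Sym M → A[X_i]` that sends `x ∈ M` to `∑ i, f i x • X_i`. -/
def evalMvPoly (f : κ → Module.Dual A M) : SymmetricAlgebra A M →ₐ[A] MvPolynomial κ A :=
  SymmetricAlgebra.lift (∑ i, (f i).smulRight (MvPolynomial.X i))

theorem evalMvPoly_ι (f : κ → Module.Dual A M) (x : M) :
    evalMvPoly f (ι A M x) = ∑ i, f i x • MvPolynomial.X i := by
  simp [evalMvPoly]

theorem dpForm_one_apply (n : ℕ) (f : Module.Dual A M) :
    dpForm n f 1 = if n = 0 then 1 else 0 := by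
  rcases n with _ | n
  · rw [dpForm_zero, symDual_one_one, if_pos rfl]
  · rw [dpForm_succ_one, if_neg (by omega)]

/-- The coefficients of `evalMvPoly` are products of divided powers. -/
theorem coeff_evalMvPoly (f : κ → Module.Dual A M) (α : κ →₀ ℕ) (t : SymmetricAlgebra A M) :
    (evalMvPoly f t).coeff α = (∏ i, dpForm (α i) (f i)) t := by
  classical
  induction t using sym_induction generalizing α with
  | one =>
    rw [map_one, MvPolynomial.coeff_one, symDual_prod_one_apply]
    simp only [dpForm_one_apply]
    rw [Finset.prod_ite_zero]
    simp [DFunLike.ext_iff, eq_comm]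
  | add s t hs ht => rw [map_add, map_add, MvPolynomial.coeff_add, hs, ht]
  | smul a t ht => rw [map_smul, map_smul, MvPolynomial.coeff_smul, ht]
  | ι_mul x t ht =>
    -- Multiplication by `∑ f i x X_i` lowers one exponent at a time when coefficients are read off;
    -- the Leibniz rule for the contraction by `x` does the same to the product of divided powers.
    rw [map_mul, evalMvPoly_ι, Finset.sum_mul, MvPolynomial.coeff_sum, ← contract_eval_apply,
      contract_prod, symDual_sum_apply]
    refine Finset.sum_congr rfl fun i _ => ?_
    rw [smul_mul_assoc, MvPolynomial.coeff_smul, MvPolynomial.coeff_X_mul']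
    by_cases hi : α i = 0
    · rw [if_neg (by simpa using hi), hi, dpForm_zero, contract_one, zero_mul, smul_zero]
      rfl
    · obtain ⟨m, hm⟩ := Nat.exists_eq_succ_of_ne_zero hi
      rw [if_pos (by simpa using hi), ht, hm, Nat.succ_eq_add_one, contract_dpForm_succ,
        ← Finset.mul_prod_erase Finset.univ (fun l => dpForm ((α - Finsupp.single i 1 : κ →₀ ℕ) l) (f l))
          (Finset.mem_univ i)]
      have h1 : (α - Finsupp.single i 1 : κ →₀ ℕ) i = m := by simp [hm]
      rw [h1, smul_mul_assoc]
      change _ = f i x • ((_ * _ : SymDual A M) t)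
      have h2 : ∏ l ∈ Finset.univ.erase i, dpForm ((α - Finsupp.single i 1 : κ →₀ ℕ) l) (f l) =
          ∏ l ∈ Finset.univ.erase i, dpForm (α l) (f l) :=
        Finset.prod_congr rfl fun l hl => by
          have hl' : l ≠ i := Finset.ne_of_mem_erase hl
          simp [Finsupp.single_eq_of_ne hl']
      rw [h2]

theorem evalMvPoly_isHomogeneous (f : κ → Module.Dual A M) {n : ℕ} {t : SymmetricAlgebra A M}
    (ht : t ∈ symPiece A M n) : (evalMvPoly f t).IsHomogeneous n := by
  induction ht using Submodule.pow_induction_on_left' with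
  | algebraMap r =>
    rw [AlgHom.commutes]
    exact MvPolynomial.isHomogeneous_C _ _
  | add x y i hx hy ihx ihy => rw [map_add]; exact ihx.add ihy
  | mem_mul m hm i x hx ih =>
    obtain ⟨m, rfl⟩ := hm
    rw [map_mul, evalMvPoly_ι, Nat.succ_eq_add_one, add_comm]
    refine MvPolynomial.IsHomogeneous.mul (MvPolynomial.IsHomogeneous.sum _ _ _ fun i _ => ?_) ih
    rw [MvPolynomial.smul_eq_C_mul]
    simpa using (MvPolynomial.isHomogeneous_C κ (f i m)).mul (MvPolynomial.isHomogeneous_X A i)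

variable (A κ) in
/-- The homomorphism `A[X_i] → Sym(A^κ)` that sends `X_i` to the basis vector of index `i`. -/
def mvToSym [DecidableEq κ] : MvPolynomial κ A →ₐ[A] SymmetricAlgebra A (κ → A) :=
  MvPolynomial.aeval fun i => ι A (κ → A) (Pi.single i 1)

theorem evalMvPoly_mvToSym [DecidableEq κ] (q : MvPolynomial κ A) :
    evalMvPoly (fun i => LinearMap.proj (R := A) (φ := fun _ : κ => A) i) (mvToSym A κ q) = q := by
  have : (evalMvPoly fun i => LinearMap.proj (R := A) (φ := fun _ : κ => A) i).comp
      (mvToSym A κ) = AlgHom.id A _ := by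
    ext i : 1
    rw [AlgHom.comp_apply, mvToSym, MvPolynomial.aeval_X, evalMvPoly_ι]
    simp [Pi.single_apply]
  exact DFunLike.congr_fun this q

theorem dpHom_prod_dp {N : Type*} [AddCommGroup N] [Module A N] (j : N →ₗ[A] Module.Dual A M)
    (α : κ →₀ ℕ) (y : κ → N) :
    dpHom j (α.prod fun i n => DividedPowerAlgebra.dp A n (y i)) =
      ∏ i, dpForm (α i) (j (y i)) := by
  rw [Finsupp.prod_fintype _ _ fun i => DividedPowerAlgebra.dp_zero, map_prod]
  exact Finset.prod_congr rfl fun i _ => dpHom_dp j _ _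

/-- For a free module of finite rank, the divided power algebra embeds into the dual of the
symmetric algebra of the dual. -/
theorem dpHom_injective_of_free [DecidableEq κ] {j : (κ → A) →ₗ[A] Module.Dual A (κ → A)}
    (hj : ∀ i, j (Pi.single i 1) = LinearMap.proj i) : Function.Injective (dpHom j) := by
  rw [injective_iff_map_eq_zero]
  intro z hz
  have hspan : Submodule.span A (Set.range fun i : κ => (Pi.single i 1 : κ → A)) = ⊤ := by
    have := (Pi.basisFun A κ).span_eq
    convert this using 3
    ext i
    simp
  -- Only the spanning property of the divided monomials is used here; evaluating at the monomials
  -- of `Sym(A^κ)` then shows that the coefficients vanish.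
  have hz' : z ∈ Submodule.span A (Set.range fun α : κ →₀ ℕ =>
      α.prod fun i n => DividedPowerAlgebra.dp A n (Pi.single i 1 : κ → A)) := by
    rw [DividedPowerAlgebra.submodule_span_prod_dp_eq_top hspan]
    trivial
  obtain ⟨b, rfl⟩ := (Finsupp.mem_span_range_iff_exists_finsupp).1 hz'
  suffices h : b = 0 by rw [h]; simp
  ext β
  have h1 := congrArg (fun u : SymDual A (κ → A) => u (mvToSym A κ (MvPolynomial.monomial β 1))) hz
  simp only [Finsupp.sum, map_sum, map_smul, dpHom_prod_dp, hj, symDual_sum_apply] at h1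
  rw [Finset.sum_congr rfl (g := fun α => if α = β then b α else 0)] at h1
  · simpa using h1
  · intro α _
    change b α • (∏ i, dpForm (α i) (LinearMap.proj i) : SymDual A (κ → A)) _ = _
    rw [← coeff_evalMvPoly, evalMvPoly_mvToSym, MvPolynomial.coeff_monomial]
    simp [eq_comm]

variable {N : Type*} [AddCommGroup N] [Module A N]

/-- Reduction to the free case. The dual basis makes `N` a retract of `A^κ`, hence `Γ N` a retract
of `Γ(A^κ)`, and extending forms to the bidual followed by pullback to `Sym(A^κ)` intertwines `dpHom
j` with the map for `A^κ`. -/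
theorem dpHom_injective_of_dual_basis {f : κ → N} {c : κ → Module.Dual A (Module.Dual A M)}
    (j : N ≃ₗ[A] Module.Dual A M) (hf : ∀ y, ∑ i, c i (j y) • f i = y) :
    Function.Injective (dpHom j.toLinearMap) := by
  classical
  have hc := contract_comm (f := fun i => j (f i)) (c := c) fun g => by
    have := congrArg j (hf (j.symm g))
    simpa using this
  rw [injective_iff_map_eq_zero]
  intro z hz
  let e : (κ → A) →ₗ[A] Module.Dual A (Module.Dual A M) := Fintype.linearCombination A c
  let co : N →ₗ[A] (κ → A) := LinearMap.pi fun i => c i ∘ₗ j.toLinearMap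
  let p : (κ → A) →ₗ[A] N := Fintype.linearCombination A f
  let j₀ : (κ → A) →ₗ[A] Module.Dual A (κ → A) :=
    Fintype.linearCombination A fun i => LinearMap.proj i
  have hj₀ : ∀ i, j₀ (Pi.single i 1) = LinearMap.proj i := fun i => by
    simp [j₀, Fintype.linearCombination_apply_single]
  -- Both maps send `y` to the linear form on `A^κ` whose coordinates are `c i (j y)`.
  have h1 : e.flip ∘ₗ j.toLinearMap = j₀ ∘ₗ co := by
    ext y i
    simp [e, j₀, co, Fintype.linearCombination_apply, Pi.single_apply]
  have h2 : dpHom (j₀ ∘ₗ co) = (dpHom j₀).comp (DividedPowerAlgebra.map A co) := by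
    refine DividedPowerAlgebra.algHom_ext fun n y => ?_
    rw [dpHom_dp, AlgHom.comp_apply, DividedPowerAlgebra.map_apply_dp, dpHom_dp]
    rfl
  have h3 : (DividedPowerAlgebra.map A p).comp (DividedPowerAlgebra.map A co) =
      AlgHom.id A (DividedPowerAlgebra A N) := by
    refine DividedPowerAlgebra.algHom_ext fun n y => ?_
    rw [AlgHom.comp_apply, DividedPowerAlgebra.map_apply_dp, DividedPowerAlgebra.map_apply_dp]
    have : p (co y) = y := by simpa [p, co, Fintype.linearCombination_apply] using hf y
    rw [this]
    rfl
  have h4 : dpHom j₀ (DividedPowerAlgebra.map A co z) = 0 := by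
    have := bidualExtend_dpHom e hc j.toLinearMap z
    rw [hz, map_zero, h1, h2] at this
    exact this.symm
  have h5 := (injective_iff_map_eq_zero _).1 (dpHom_injective_of_free hj₀) _ h4
  have h6 := DFunLike.congr_fun h3 z
  rw [AlgHom.comp_apply, h5, map_zero] at h6
  exact h6.symm

/-- The composite `M → A^κ → M^{**}` is `x ↦ ∑ f i x • c i`, which is evaluation at `x` by the dual
basis identity. Thus `u` factors through the polynomial ring `A[X_i]`. -/
theorem bidualExtend_evalMvPoly [DecidableEq κ] {f : κ → Module.Dual A M}
    {c : κ → Module.Dual A (Module.Dual A M)}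
    (hc : ∀ (c d : Module.Dual A (Module.Dual A M)) (u : SymDual A M),
      contract c (contract d u) = contract d (contract c u))
    (hf : ∀ g, ∑ i, c i g • f i = g) (u : SymDual A M) (t : SymmetricAlgebra A M) :
    bidualExtend (Fintype.linearCombination A c) hc u (mvToSym A κ (evalMvPoly f t)) = u t := by
  induction t using sym_induction generalizing u with
  | one => rw [map_one, map_one, bidualExtend_one_apply]
  | add s t hs ht => rw [map_add, map_add, map_add, map_add, hs, ht]
  | smul a t ht => rw [map_smul, map_smul, map_smul, map_smul, ht]
  | ι_mul x t ht =>
    have h : mvToSym A κ (evalMvPoly f (ι A M x)) = ι A (κ → A) fun i => f i x := by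
      rw [evalMvPoly_ι, map_sum]
      simp only [map_smul, mvToSym, MvPolynomial.aeval_X]
      simp only [← map_smul, ← map_sum]
      congr 1
      ext i
      simp [Pi.single_apply]
    rw [map_mul, map_mul, h, bidualExtend_ι_mul, ht, contract_apply]
    conv_rhs => rw [← slice_apply, ← hf (slice u t)]
    simp [Fintype.linearCombination_apply, mul_comm]

/-- Since `u` factors through `A[X_i]` as `û`, expanding in monomials gives `u = ∑ û(X^α) ∏ (j (f
i))^{[α i]}`, a combination of images of divided monomials. Homogeneity of `u` cuts the sum down to
the finitely many `α` of total degree `n`. -/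
theorem mem_range_dpHom_of_dual_basis {f : κ → N} {c : κ → Module.Dual A (Module.Dual A M)}
    (j : N ≃ₗ[A] Module.Dual A M) (hf : ∀ y, ∑ i, c i (j y) • f i = y) {n : ℕ}
    {u : SymDual A M} (hu : ∀ m, m ≠ n → ∀ s ∈ symPiece A M m, u s = 0) :
    ∃ z, dpHom j.toLinearMap z = u := by
  classical
  have hf' : ∀ g, ∑ i, c i g • j (f i) = g := fun g => by
    have := congrArg j (hf (j.symm g))
    simpa using this
  have hc := contract_comm (f := fun i => j (f i)) hf'
  let û : MvPolynomial κ A →ₗ[A] A :=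
    (bidualExtend (Fintype.linearCombination A c) hc u).ofConv ∘ₗ (mvToSym A κ).toLinearMap
  have hû : ∀ t, û (evalMvPoly (fun i => j (f i)) t) = u t :=
    bidualExtend_evalMvPoly hc hf' u
  refine ⟨∑ α ∈ Finset.finsuppAntidiag Finset.univ n, û (MvPolynomial.monomial α 1) •
    α.prod fun i n => DividedPowerAlgebra.dp A n (f i), ?_⟩
  refine WithConv.ext (symPiece_hom_ext fun m t ht => ?_)
  have hhom := evalMvPoly_isHomogeneous (fun i => j (f i)) ht
  simp only [map_sum, map_smul, dpHom_prod_dp]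
  change (∑ α ∈ Finset.finsuppAntidiag Finset.univ n, û (MvPolynomial.monomial α 1) •
    (∏ i, dpForm (α i) (j (f i)) : SymDual A M)) t = u t
  rw [symDual_sum_apply]
  have e : ∀ α : κ →₀ ℕ, (û (MvPolynomial.monomial α 1) •
      (∏ i, dpForm (α i) (j (f i)) : SymDual A M)) t =
      û (MvPolynomial.monomial α ((evalMvPoly (fun i => j (f i)) t).coeff α)) := by
    intro α
    change û (MvPolynomial.monomial α 1) • (∏ i, dpForm (α i) (j (f i)) : SymDual A M) t = _
    rw [← coeff_evalMvPoly (fun i => j (f i)), smul_eq_mul, mul_comm, ← smul_eq_mul, ← map_smul,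
      MvPolynomial.smul_monomial, smul_eq_mul, mul_one]
  rw [Finset.sum_congr rfl fun α _ => e α]
  have hdeg : ∀ α : κ →₀ ℕ, (evalMvPoly (fun i => j (f i)) t).coeff α ≠ 0 → ∑ i, α i = m := by
    intro α hα
    simpa [Finsupp.weight_apply, Finsupp.sum_fintype] using hhom hα
  by_cases hmn : m = n
  · subst hmn
    rw [← hû]
    conv_rhs => rw [← MvPolynomial.support_sum_monomial_coeff (evalMvPoly (fun i => j (f i)) t)]
    rw [map_sum]
    symm
    refine Finset.sum_subset (fun α hα => ?_) fun α _ hα => ?_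
    · rw [Finset.mem_finsuppAntidiag]
      exact ⟨hdeg α (MvPolynomial.mem_support_iff.1 hα), Finset.subset_univ _⟩
    · rw [MvPolynomial.notMem_support_iff.1 hα, map_zero, map_zero]
  -- In degree `m ≠ n` the polynomial of `t` has no monomials of degree `n`, so the sum vanishes
  -- like `u`.
  · rw [hu m hmn t ht]
    refine Finset.sum_eq_zero fun α hα => ?_
    rw [Finset.mem_finsuppAntidiag] at hα
    have : (evalMvPoly (fun i => j (f i)) t).coeff α = 0 := by
      by_contra h
      exact hmn ((hdeg α h).symm.trans hα.1)
    rw [this, map_zero, map_zero]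

theorem exists_dual_basis (A N : Type*) [CommRing A] [AddCommGroup N] [Module A N]
    [Module.Finite A N] [Module.Projective A N] :
    ∃ (n : ℕ) (f : Fin n → N) (c : Fin n → Module.Dual A N), ∀ y, ∑ i, c i y • f i = y := by
  obtain ⟨n, p, hp⟩ := Module.Finite.exists_fin' A N
  obtain ⟨s, hs⟩ := Module.projective_lifting_property p LinearMap.id hp
  refine ⟨n, fun i => p (Pi.single i 1), fun i => LinearMap.proj i ∘ₗ s, fun y => ?_⟩
  have h : p (s y) = y := LinearMap.congr_fun hs y
  simp only [← map_smul, ← map_sum]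
  convert h using 2
  ext i
  simp [Pi.single_apply]

variable [Module.Finite A N] [Module.Projective A N] (j : N ≃ₗ[A] Module.Dual A M)

/-- If `N = M^*` is finitely generated projective, `Γ N` embeds into the dual of `Sym M`. -/
theorem dpHom_injective : Function.Injective (dpHom j.toLinearMap) := by
  obtain ⟨n, f, c, h⟩ := exists_dual_basis A N
  exact dpHom_injective_of_dual_basis (f := f) (c := fun i => c i ∘ₗ j.symm.toLinearMap) j
    fun y => by simpa using h y

/-- If `N = M^*` is finitely generated projective, every homogeneous form on `Sym M` comes from
`Γ N`. -/
theorem mem_range_dpHom {n : ℕ} {u : SymDual A M}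
    (hu : ∀ m, m ≠ n → ∀ s ∈ symPiece A M m, u s = 0) : ∃ z, dpHom j.toLinearMap z = u := by
  obtain ⟨n, f, c, h⟩ := exists_dual_basis A N
  exact mem_range_dpHom_of_dual_basis (f := f) (c := fun i => c i ∘ₗ j.symm.toLinearMap) j
    (fun y => by simpa using h y) hu

end DividedPowersOfDual

/-! ### The graded dual inside the full dual -/

section ExtendForms

open SymmetricAlgebra WithConv

variable (A M : Type*) [CommRing A] [AddCommGroup M] [Module A M]

/-- Extension by zero of forms on `Sym^n M`, as a linear map. -/
def extendPiece (n : ℕ) : DualPiece A M n →ₗ[A] SymDual A M where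
  toFun u := u.extend
  map_add' := DualPiece.extend_add
  map_smul' := DualPiece.extend_smul

/-- The embedding of the graded dual of `Sym M` into its full dual. -/
def extendHom : GradedDual A M →ₐ[A] SymDual A M :=
  DirectSum.toAlgebra A (DualPiece A M) (extendPiece A M) DualPiece.extend_one
    DualPiece.extend_mul

variable {A M}

theorem extendHom_of (n : ℕ) (u : DualPiece A M n) :
    extendHom A M (DirectSum.of (DualPiece A M) n u) = u.extend := by
  have h : ∀ x, extendHom A M x =
      DirectSum.toAddMonoid (fun i => (extendPiece A M i).toAddMonoidHom) x := fun _ => rfl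
  rw [h, DirectSum.toAddMonoid_of]
  rfl

theorem restrict_extendHom (n : ℕ) (x : GradedDual A M) :
    DualPiece.restrict n (extendHom A M x) = x n := by
  induction x using DirectSum.induction_on with
  | zero => rw [map_zero]; rfl
  | of m u =>
    rw [extendHom_of]
    by_cases h : m = n
    · subst h
      rw [DualPiece.restrict_extend, DirectSum.of_eq_same]
    · rw [DirectSum.of_eq_of_ne _ _ _ (Ne.symm h)]
      exact LinearMap.ext fun s => u.extend_of_ne (Ne.symm h) s.2
  | add x y hx hy =>
    rw [map_add, DirectSum.add_apply, ← hx, ← hy]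
    rfl

theorem extendHom_injective : Function.Injective (extendHom A M) := fun x y h => by
  refine DFinsupp.ext fun n => ?_
  rw [← restrict_extendHom, ← restrict_extendHom, h]

theorem ι_mul_mem_symPiece {n : ℕ} (x : M) {t : SymmetricAlgebra A M}
    (ht : t ∈ symPiece A M n) : ι A M x * t ∈ symPiece A M (n + 1) := by
  rw [symPiece, pow_succ']
  exact Submodule.mul_mem_mul ⟨x, rfl⟩ ht

theorem one_mem_symPiece : (1 : SymmetricAlgebra A M) ∈ symPiece A M 0 := by
  rw [symPiece, pow_zero]
  exact Submodule.one_le.1 le_rfl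

end ExtendForms

/-! ### Symbols of differential operators as forms on `Sym Ω` -/

section ThetaForm

open SymmetricAlgebra WithConv

variable {k A : Type*} [CommRing k] [CommRing A] [Algebra k A]

/-- Absorbs the change of index between degrees such as `1 + i` and `i + 1`, which are equal but not
definitionally so. -/
theorem of_mk_congr {R : Type*} [Ring R] [Module A R] {F G : ℕ → Submodule A R} {i j : ℕ}
    (h : i = j) {x : ↥(F i)} {y : ↥(F j)} (hxy : (x : R) = y) :
    DirectSum.of (GrPiece F G) i (GrPiece.mk F G i x) =
      DirectSum.of (GrPiece F G) j (GrPiece.mk F G j y) :=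
  DirectSum.of_eq_of_gradedMonoid_eq
    (GrPiece.sigma_ext h (by rw [hxy, sub_self]; exact zero_mem _))

theorem upsilon_ι_D (a : A) :
    upsilon k A (ι A Ω[A⁄k] (KaehlerDifferential.D k A a)) =
      DirectSum.of (GrPiece (diagPow k A) (diagPowSucc k A)) 1
        (GrPiece.mk _ _ 1 ⟨1 ⊗ₜ[k] a - a ⊗ₜ[k] 1, diag_mem k a⟩) := by
  rw [upsilon, SymmetricAlgebra.lift_ι_apply, LinearMap.comp_apply,
    Derivation.liftKaehlerDifferential_comp_D]
  rfl

theorem upsilon_of_mem {n : ℕ} {s : SymmetricAlgebra A Ω[A⁄k]} (hs : s ∈ symPiece A Ω[A⁄k] n) :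
    ∃ z, upsilon k A s =
      DirectSum.of (GrPiece (diagPow k A) (diagPowSucc k A)) n (GrPiece.mk _ _ n z) := by
  induction hs using Submodule.pow_induction_on_left' with
  | algebraMap r => exact ⟨_, AlgHom.commutes _ r⟩
  | add x y i hx hy ihx ihy =>
    obtain ⟨z, hz⟩ := ihx
    obtain ⟨w, hw⟩ := ihy
    exact ⟨z + w, by rw [map_add, hz, hw, map_add, map_add]⟩
  | mem_mul x hx i t ht ih =>
    obtain ⟨x, rfl⟩ := hx
    obtain ⟨z, hz⟩ := ih
    obtain ⟨w, hw⟩ := GrPiece.mk_surjective 1 ((diagDer k A).liftKaehlerDifferential x)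
    have hx : upsilon k A (ι A Ω[A⁄k] x) =
        DirectSum.of (GrPiece (diagPow k A) (diagPowSucc k A)) 1 (GrPiece.mk _ _ 1 w) := by
      rw [upsilon, SymmetricAlgebra.lift_ι_apply, hw]
      rfl
    rw [map_mul, hx, hz, DirectSum.of_mul_of, GrPiece.mk_mul_mk]
    refine ⟨⟨(w : A ⊗[k] A) * z, ?_⟩, of_mk_congr (add_comm 1 i) rfl⟩
    have := IsGrPair.mul_mem (G := diagPowSucc k A) w.2 z.2
    rwa [add_comm] at this

/-- The form on `Sym Ω_{A/k}` defined by `θ_n(σ_n(P))`, extended by zero to the other degrees. -/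
def thetaForm (n : ℕ) : ↥(diffOp k A n) →ₗ[A] SymDual A Ω[A⁄k] where
  toFun P := (thetaPiece k A n (GrPiece.mk _ _ n P)).extend
  map_add' P Q := by rw [map_add, map_add, DualPiece.extend_add]
  map_smul' a P := by rw [map_smul, map_smul, DualPiece.extend_smul, RingHom.id_apply]

theorem thetaForm_def (n : ℕ) (P : ↥(diffOp k A n)) :
    thetaForm n P = (thetaPiece k A n (GrPiece.mk _ _ n P)).extend := rfl

theorem thetaForm_apply {n : ℕ} (P : ↥(diffOp k A n)) {s : SymmetricAlgebra A Ω[A⁄k]}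
    (hs : s ∈ symPiece A Ω[A⁄k] n) {z : ↥(diagPow k A n)}
    (hz : upsilon k A s = DirectSum.of (GrPiece (diagPow k A) (diagPowSucc k A)) n
      (GrPiece.mk _ _ n z)) :
    thetaForm n P s = linearize (P : Module.End k A) z := by
  have h1 : thetaForm n P s = lambda k A n (GrPiece.mk _ _ n P)
      (upsilon k A (symProj A Ω[A⁄k] n s) n) := rfl
  rw [h1, symProj_same ⟨s, hs⟩]
  change lambda k A n (GrPiece.mk _ _ n P) (upsilon k A s n) = _
  rw [hz, DirectSum.of_eq_same]
  rfl

theorem thetaForm_of_ne {n m : ℕ} (P : ↥(diffOp k A n)) (h : m ≠ n)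
    {s : SymmetricAlgebra A Ω[A⁄k]} (hs : s ∈ symPiece A Ω[A⁄k] m) : thetaForm n P s = 0 :=
  DualPiece.extend_of_ne _ h hs

theorem linearize_diag_mul (P : Module.End k A) (a : A) (z : A ⊗[k] A) :
    linearize P ((1 ⊗ₜ[k] a - a ⊗ₜ[k] 1) * z) = linearize (bracket k a P) z := by
  induction z using TensorProduct.induction_on with
  | zero => simp
  | tmul x y =>
    rw [sub_mul, map_sub, Algebra.TensorProduct.tmul_mul_tmul,
      Algebra.TensorProduct.tmul_mul_tmul, linearize_tmul, linearize_tmul, linearize_tmul,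
      bracket_apply, one_mul, one_mul]
    ring
  | add x y hx hy => rw [mul_add, map_add, map_add, hx, hy]

/-- The link between the two calculi: `υ(da)` is the class of `1 ⊗ a - a ⊗ 1`, and multiplying by
this element before applying the linearization of `P` is the linearization of `[P, a]`. -/
theorem contract_thetaForm_succ {n : ℕ} (P : ↥(diffOp k A (n + 1))) (a : A) :
    contract (Module.Dual.eval A _ (KaehlerDifferential.D k A a)) (thetaForm (n + 1) P) =
      thetaForm n ⟨bracket k a P, P.2 a⟩ := by
  refine WithConv.ext (symPiece_hom_ext fun m t ht => ?_)
  change thetaForm (n + 1) P (ι A _ (KaehlerDifferential.D k A a) * t) =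
    thetaForm n ⟨bracket k a P, P.2 a⟩ t
  have ht' := ι_mul_mem_symPiece (KaehlerDifferential.D k A a) ht
  by_cases h : m = n
  · subst h
    obtain ⟨z, hz⟩ := upsilon_of_mem ht
    have hz' : ((1 : A) ⊗ₜ[k] a - a ⊗ₜ[k] (1 : A)) * (z : A ⊗[k] A) ∈ diagPow k A (m + 1) := by
      have := IsGrPair.mul_mem (G := diagPowSucc k A) (diag_mem k a) z.2
      rwa [add_comm] at this
    rw [thetaForm_apply _ ht hz, thetaForm_apply (z := ⟨_, hz'⟩) _ ht', linearize_diag_mul]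
    rw [map_mul, upsilon_ι_D, hz, DirectSum.of_mul_of, GrPiece.mk_mul_mk]
    exact of_mk_congr (add_comm 1 m) rfl
  · rw [thetaForm_of_ne _ h ht, thetaForm_of_ne _ (by omega) ht']

theorem contract_thetaForm_zero (P : ↥(diffOp k A 0)) (x : Ω[A⁄k]) :
    contract (Module.Dual.eval A _ x) (thetaForm 0 P) = 0 := by
  refine WithConv.ext (symPiece_hom_ext fun m t ht => ?_)
  exact thetaForm_of_ne P (by omega) (ι_mul_mem_symPiece x ht)

theorem thetaForm_zero_one (P : ↥(diffOp k A 0)) :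
    thetaForm 0 P 1 = (P : Module.End k A) 1 := by
  rw [thetaForm_apply (z := ⟨1, IsGrPair.one_mem (diagPowSucc k A)⟩) P one_mem_symPiece]
  · exact (linearize_tmul (P : Module.End k A) 1 1).trans (one_mul _)
  · rw [map_one]
    rfl

theorem thetaForm_succ_one {n : ℕ} (P : ↥(diffOp k A (n + 1))) : thetaForm (n + 1) P 1 = 0 :=
  thetaForm_of_ne P (by omega) one_mem_symPiece

/-- Contractions by differentials suffice, since these span `Ω`; for them contraction is a bracket.
-/
theorem symDual_ext_D {u v : SymDual A Ω[A⁄k]} (h1 : u 1 = v 1)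
    (h : ∀ a, contract (Module.Dual.eval A _ (KaehlerDifferential.D k A a)) u =
      contract (Module.Dual.eval A _ (KaehlerDifferential.D k A a)) v) : u = v := by
  refine symDual_ext h1 fun x t => ?_
  have hx : x ∈ Submodule.span A (Set.range (KaehlerDifferential.D k A)) := by
    rw [KaehlerDifferential.span_range_derivation]
    trivial
  induction hx using Submodule.span_induction with
  | mem x hx =>
    obtain ⟨a, rfl⟩ := hx
    rw [← contract_eval_apply, h, contract_eval_apply]
  | zero => simp
  | add x y _ _ hx hy => rw [map_add, add_mul, map_add, map_add, hx, hy]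
  | smul a x _ hx => rw [map_smul, smul_mul_assoc, map_smul, map_smul, hx]

theorem thetaForm_eq_zero {n : ℕ} (P : ↥(diffOp k A n))
    (h : (P : Module.End k A) ∈ diffOpPred k A n) :
    thetaForm n P = 0 := by
  have : GrPiece.mk (diffOp k A) (diffOpPred k A) n P = 0 := by
    rw [← map_zero (GrPiece.mk (diffOp k A) (diffOpPred k A) n), GrPiece.mk_eq_mk]
    simpa using h
  rw [thetaForm_def, this, map_zero, DualPiece.extend_zero]

/-- The symbol of a differential operator is determined by the form it defines. -/
theorem mem_diffOpPred_of_thetaForm_eq_zero {n : ℕ} (P : ↥(diffOp k A n))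
    (h : thetaForm n P = 0) : (P : Module.End k A) ∈ diffOpPred k A n := by
  induction n with
  | zero =>
    have h1 : (P : Module.End k A) 1 = 0 := by rw [← thetaForm_zero_one, h]; rfl
    refine (Submodule.mem_bot A).2 (LinearMap.ext fun x => ?_)
    have := P.2 x 1
    rwa [mul_one, h1, mul_zero] at this
  | succ n ih =>
    rw [mem_diffOpPred_succ]
    intro a
    refine ih ⟨bracket k a P, P.2 a⟩ ?_
    rw [← contract_thetaForm_succ, h, map_zero]

/-- Brackets act as derivations on composition of operators, contractions as derivations on the
convolution product, so both sides satisfy the same recursion. The composite is a separate variable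
`R` of order `s`, which avoids transport along `i + j = s`. -/
theorem thetaForm_mul (s : ℕ) : ∀ (i j : ℕ), i + j = s → ∀ (P : ↥(diffOp k A i))
    (Q : ↥(diffOp k A j)) (R : ↥(diffOp k A s)),
    (R : Module.End k A) = (P : Module.End k A) * (Q : Module.End k A) →
    thetaForm s R = thetaForm i P * thetaForm j Q := by
  induction s with
  | zero =>
    intro i j h P Q R hR
    obtain ⟨rfl, rfl⟩ : i = 0 ∧ j = 0 := by omega
    refine symDual_ext_contract ?_ fun x => ?_
    · rw [symDual_mul_one_apply, thetaForm_zero_one, thetaForm_zero_one, thetaForm_zero_one, hR,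
        Module.End.mul_apply]
      have := P.2 ((Q : Module.End k A) 1) 1
      rw [mul_one] at this
      rw [this, mul_comm]
    · rw [contract_mul, contract_thetaForm_zero, contract_thetaForm_zero, contract_thetaForm_zero,
        zero_mul, mul_zero, add_zero]
  | succ s ih =>
    intro i j h P Q R hR
    refine symDual_ext_D ?_ fun a => ?_
    · rw [symDual_mul_one_apply, thetaForm_succ_one]
      rcases i with _ | i
      · obtain rfl : j = s + 1 := by omega
        rw [thetaForm_succ_one, mul_zero]
      · rw [thetaForm_succ_one, zero_mul]
    have hb : bracket k a (R : Module.End k A) = (P : Module.End k A) * bracket k a Q +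
        bracket k a P * (Q : Module.End k A) := by rw [hR, bracket_mul]
    -- If `P` has order zero, then `[P, a] = 0` and there is no form of smaller degree, so `U = 0`
    -- is taken; likewise for `Q` below.
    have hleft : ∃ U : ↥(diffOp k A s), (U : Module.End k A) = bracket k a P * Q ∧
        thetaForm s U = contract (Module.Dual.eval A _ (KaehlerDifferential.D k A a))
          (thetaForm i P) * thetaForm j Q := by
      rcases i with _ | i
      · refine ⟨0, ?_, by rw [contract_thetaForm_zero, map_zero, zero_mul]⟩
        have : bracket k a (P : Module.End k A) = 0 :=
          LinearMap.ext fun x => by rw [bracket_apply, P.2 a x, sub_self]; rfl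
        rw [this, zero_mul]; rfl
      · obtain rfl : i + j = s := by omega
        refine ⟨⟨_, IsGrPair.mul_mem (G := diffOpPred k A) (P.2 a) Q.2⟩, rfl, ?_⟩
        rw [contract_thetaForm_succ]
        exact ih i j rfl ⟨_, P.2 a⟩ Q _ rfl
    have hright : ∃ U : ↥(diffOp k A s), (U : Module.End k A) = P * bracket k a Q ∧
        thetaForm s U = thetaForm i P *
          contract (Module.Dual.eval A _ (KaehlerDifferential.D k A a)) (thetaForm j Q) := by
      rcases j with _ | j
      · refine ⟨0, ?_, by rw [contract_thetaForm_zero, map_zero, mul_zero]⟩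
        have : bracket k a (Q : Module.End k A) = 0 :=
          LinearMap.ext fun x => by rw [bracket_apply, Q.2 a x, sub_self]; rfl
        rw [this, mul_zero]; rfl
      · obtain rfl : i + j = s := by omega
        refine ⟨⟨_, IsGrPair.mul_mem (G := diffOpPred k A) P.2 (Q.2 a)⟩, rfl, ?_⟩
        rw [contract_thetaForm_succ]
        exact ih i j rfl P ⟨_, Q.2 a⟩ _ rfl
    obtain ⟨U, hU, hU'⟩ := hleft
    obtain ⟨V, hV, hV'⟩ := hright
    rw [contract_mul, contract_thetaForm_succ, ← hU', ← hV', ← map_add]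
    congr 1
    refine Subtype.ext ?_
    change bracket k a (R : Module.End k A) = U + V
    rw [hb, hU, hV, add_comm]

variable (k A)

theorem thetaPiece_injective (n : ℕ) : Function.Injective (thetaPiece k A n) := by
  rw [injective_iff_map_eq_zero]
  intro x hx
  obtain ⟨P, rfl⟩ := GrPiece.mk_surjective n x
  have h := mem_diffOpPred_of_thetaForm_eq_zero P (by rw [thetaForm_def, hx]; rfl)
  rw [← map_zero (GrPiece.mk (diffOp k A) (diffOpPred k A) n), GrPiece.mk_eq_mk]
  simpa using h

theorem theta_injective : Function.Injective (theta k A) :=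
  (DirectSum.lmap_injective _).2 (thetaPiece_injective k A)

variable {k A}

theorem extendHom_theta_symbol (n : ℕ) (P : ↥(diffOp k A n)) :
    extendHom A Ω[A⁄k] (theta k A (symbol n P)) = thetaForm n P := by
  rw [theta, symbol, DirectSum.lmap_of, extendHom_of, thetaForm_def]

theorem symbol_induction {p : GrDiff k A → Prop} (zero : p 0)
    (symbol : ∀ n P, p (symbol n P)) (add : ∀ x y, p x → p y → p (x + y)) (x : GrDiff k A) :
    p x := by
  induction x using DirectSum.induction_on with
  | zero => exact zero
  | of n x =>
    obtain ⟨P, rfl⟩ := GrPiece.mk_surjective n x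
    exact symbol n P
  | add x y hx hy => exact add x y hx hy

theorem theta_mul (x y : GrDiff k A) : theta k A (x * y) = theta k A x * theta k A y := by
  induction x using symbol_induction with
  | zero => rw [zero_mul, map_zero, zero_mul]
  | add x x' hx hx' => rw [add_mul, map_add, map_add, add_mul, hx, hx']
  | symbol i P =>
    induction y using symbol_induction with
    | zero => rw [mul_zero, map_zero, mul_zero]
    | add y y' hy hy' => rw [mul_add, map_add, map_add, mul_add, hy, hy']
    | symbol j Q =>
      refine extendHom_injective ?_
      rw [map_mul (extendHom A Ω[A⁄k]), symbol_mul, extendHom_theta_symbol,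
        extendHom_theta_symbol, extendHom_theta_symbol]
      exact thetaForm_mul _ i j rfl P Q _ rfl

theorem theta_one : theta k A 1 = 1 := by
  refine extendHom_injective ?_
  rw [map_one (extendHom A Ω[A⁄k])]
  change extendHom A _ (theta k A (symbol 0 ⟨1, IsGrPair.one_mem (diffOpPred k A)⟩)) = 1
  rw [extendHom_theta_symbol]
  refine symDual_ext_contract ?_ fun x => ?_
  · rw [thetaForm_zero_one, symDual_one_one]; rfl
  · rw [contract_thetaForm_zero, contract_one]

variable (k A) in
/-- `θ_{A/k}` as a homomorphism of algebras. -/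
def thetaAlgHom : GrDiff k A →ₐ[A] GradedDual A Ω[A⁄k] :=
  AlgHom.ofLinearMap (theta k A) theta_one theta_mul

theorem HasseSchmidt.bracket_succ_sub_mem (D : HasseSchmidt k A) (n : ℕ) (a : A) :
    bracket k a (D.D (n + 1)) - D.D 1 a • D.D n ∈ diffOpPred k A n := by
  rw [D.bracket_eq, Finset.sum_range_succ, show n + 1 - n = 1 by omega, add_sub_cancel_right]
  exact sum_mem fun l hl => Submodule.smul_mem _ _
    (diffOpPred_mono (show l + 1 ≤ n from Finset.mem_range.1 hl) (D.mem_diffOp l))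

/-- Modulo lower order, `[D_{n+1}, a]` is `δ(a) D_n`. This is the recursion that contraction by `da`
gives for divided powers. -/
theorem HasseSchmidt.thetaForm_eq (D : HasseSchmidt k A) (δ : Derivation k A A)
    (h : D.D 1 = (δ : A →ₗ[k] A)) (n : ℕ) :
    thetaForm n ⟨D.D n, D.mem_diffOp n⟩ = dpForm n δ.liftKaehlerDifferential := by
  induction n with
  | zero =>
    rw [dpForm_zero]
    refine symDual_ext_contract ?_ fun x => ?_
    · rw [thetaForm_zero_one, symDual_one_one]
      exact LinearMap.congr_fun D.zero_eq 1
    · rw [contract_thetaForm_zero, contract_one]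
  | succ n ih =>
    refine symDual_ext_D ?_ fun a => ?_
    · rw [thetaForm_succ_one, dpForm_succ_one]
    · rw [contract_thetaForm_succ, contract_dpForm_succ, ← ih, ← map_smul, ← sub_eq_zero,
        ← map_sub]
      refine thetaForm_eq_zero _ ?_
      have := D.bracket_succ_sub_mem n a
      rw [h] at this
      simpa using this

variable (k A) in
/-- The linear form on `Ω_{A/k}` defined by an integrable derivation. -/
def iderToDual : IDer k A →ₗ[A] Module.Dual A Ω[A⁄k] :=
  (KaehlerDifferential.linearMapEquivDerivation k A).symm.toLinearMap ∘ₗ (IDer k A).subtype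

theorem iderToDual_D (δ : IDer k A) (a : A) :
    iderToDual k A δ (KaehlerDifferential.D k A a) = (δ : Derivation k A A) a :=
  Derivation.liftKaehlerDifferential_comp_D _ a

/-- The composition of `ϑ_{A/k}` and `θ_{A/k}` is the canonical map `Γ IDer_k(A) → (Sym Ω)^*`. -/
theorem extendHom_theta_vartheta (z : DividedPowerAlgebra A (IDer k A)) :
    extendHom A _ (theta k A (vartheta k A z)) = dpHom (iderToDual k A) z := by
  have : ((extendHom A _).comp (thetaAlgHom k A)).comp (vartheta k A) =
      dpHom (iderToDual k A) := by
    refine DividedPowerAlgebra.algHom_ext fun n δ => ?_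
    obtain ⟨D, hD⟩ := δ.2
    rw [dpHom_dp]
    change extendHom A _ (theta k A (vartheta k A (DividedPowerAlgebra.dp A n δ))) = _
    rw [vartheta, DividedPowerAlgebra.lift'_apply_dp, chi_eq δ D hD, HasseSchmidt.totalSymbol,
      extendHom_theta_symbol, D.thetaForm_eq δ hD]
    rfl
  exact DFunLike.congr_fun this z

end ThetaForm

/-! ### Closed families of forms have a potential -/

section SymmetricPotential

open SymmetricAlgebra WithConv

variable {A M : Type*} [CommRing A] [AddCommGroup M] [Module A M]

/-- The action of `M` on `(Sym M)^* × A` by contractions, in which `x ∈ M` sends the generator of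
the second factor to `h x`. -/
def potentialAction (h : M →ₗ[A] SymDual A M) : M →ₗ[A] Module.End A (SymDual A M × A) :=
  LinearMap.mk₂ A (fun x w => (contract (Module.Dual.eval A M x) w.1 + w.2 • h x, 0))
    (fun x y w => by
      simp only [map_add, smul_add, Prod.mk_add_mk, add_zero, Prod.mk.injEq, and_true]
      change contract (_ + _) w.1 + _ = _
      rw [← add_add_add_comm]
      rfl)
    (fun a x w => by
      simp only [map_smul, Prod.smul_mk, smul_zero, Prod.mk.injEq, and_true, smul_add,
        smul_comm a w.2]
      rfl)
    (fun x w w' => by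
      simp only [Prod.fst_add, Prod.snd_add, map_add, add_smul, Prod.mk_add_mk, add_zero,
        Prod.mk.injEq, and_true]
      abel)
    (fun a x w => by
      simp only [Prod.smul_fst, Prod.smul_snd, map_smul, Prod.smul_mk, smul_zero, smul_add,
        smul_assoc])

theorem potentialAction_apply (h : M →ₗ[A] SymDual A M) (x : M) (w : SymDual A M × A) :
    potentialAction h x w = (contract (Module.Dual.eval A M x) w.1 + w.2 • h x, 0) := rfl

/-- A family of forms `h x` with `h x (y t) = h y (x t)` consists of the contractions of a form. -/
theorem exists_contract_eq (h : M →ₗ[A] SymDual A M)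
    (hh : ∀ x y t, h x (ι A M y * t) = h y (ι A M x * t)) :
    ∃ u : SymDual A M, ∀ x t, u (ι A M x * t) = h x t := by
  -- The closedness condition `hh` is what makes these operators commute on the generator of the
  -- second factor, so the action of `M` extends to `Sym M`.
  have hcomm : ∀ x y, potentialAction h x * potentialAction h y =
      potentialAction h y * potentialAction h x := by
    intro x y
    refine LinearMap.ext fun w => ?_
    simp only [Module.End.mul_apply, potentialAction_apply, zero_smul, add_zero, map_add, map_smul]
    congr 2
    · ext t
      change w.1 (ι A M y * (ι A M x * t)) = w.1 (ι A M x * (ι A M y * t))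
      rw [mul_left_comm]
    · congr 1
      ext t
      exact hh y x t
  obtain ⟨ρ, hι⟩ : ∃ ρ : SymmetricAlgebra A M →ₐ[A] Module.End A (SymDual A M × A),
      ∀ x, ρ (ι A M x) = potentialAction h x := by
    refine ⟨symLift (B := Module.End A (SymDual A M × A)) (potentialAction h) hcomm, fun x => ?_⟩
    rw [symLift_ι]
  have hρ : ∀ x t w, ρ (ι A M x * t) w = ρ t (potentialAction h x w) := by
    intro x t w
    rw [mul_comm, map_mul ρ, Module.End.mul_apply, hι]
  -- On the first factor `t` acts by iterated contraction, so evaluation at `1` recovers the form.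
  have key : ∀ (t : SymmetricAlgebra A M) (w : SymDual A M), (ρ t (w, 0)).1 1 = w t := by
    intro t
    induction t using sym_induction with
    | one => intro w; rw [map_one ρ]; rfl
    | add s t hs ht =>
      intro w
      rw [map_add ρ, map_add w.ofConv, ← hs, ← ht]
      rfl
    | smul a t ht =>
      intro w
      rw [map_smul ρ, map_smul w.ofConv, ← ht]
      rfl
    | ι_mul x t ht =>
      intro w
      rw [hρ, potentialAction_apply]
      simp only [zero_smul, add_zero]
      rw [ht, contract_eval_apply]
  -- The potential is the value at `1` of `t` acting on the generator. No division by the degree is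
  -- involved, so this works in every characteristic.
  refine ⟨toConv
    { toFun := fun t => (ρ t (0, 1)).1 1
      map_add' := fun s t => by rw [map_add ρ]; rfl
      map_smul' := fun a t => by rw [map_smul ρ]; rfl }, fun x t => ?_⟩
  change (ρ (ι A M x * t) (0, 1)).1 1 = h x t
  rw [hρ, potentialAction_apply]
  simp only [map_zero, zero_add, one_smul]
  exact key t (h x)

theorem extend_restrict_apply {n : ℕ} (f : SymDual A M) {s : SymmetricAlgebra A M}
    (hs : s ∈ symPiece A M n) : (DualPiece.restrict n f).extend s = f s := by
  change f (symProj A M n s) = f s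
  rw [symProj_same ⟨s, hs⟩]

end SymmetricPotential

/-! ### Extension of truncated Hasse–Schmidt derivations -/

section Integrability

open SymmetricAlgebra WithConv

variable {k A : Type*} [CommRing k] [CommRing A] [Algebra k A]

instance {M : Type*} [AddCommGroup M] [Module A M] : IsScalarTower k A (SymDual A M) :=
  ⟨fun c a u => by
    ext t
    exact smul_assoc c a (u t)⟩

theorem diffOp_mono : Monotone (diffOp k A) :=
  fun _ _ h => diffOpPred_mono (Nat.succ_le_succ h)

theorem one_mem_diffOp (n : ℕ) : (1 : Module.End k A) ∈ diffOp k A n :=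
  diffOp_mono (Nat.zero_le n) (IsGrPair.one_mem (diffOpPred k A))

/-- A symmetric Hochschild cocycle with values in operators of order `≤ m + 1` is the coboundary of
an operator up to operators of order `≤ m`, if `θ_{m + 2}` is surjective. -/
theorem exists_bracket_sub_mem {m : ℕ} (hθ : Function.Surjective (thetaPiece k A (m + 2)))
    {E : A →ₗ[k] Module.End k A} (hm : ∀ a, E a ∈ diffOp k A (m + 1))
    (hsymm : ∀ a b, E a b = E b a)
    (hcocycle : ∀ a b c, a * E b c + E a (b * c) = E (a * b) c + E a b * c) :
    ∃ Q : ↥(diffOp k A (m + 2)), ∀ a, bracket k a Q - E a ∈ diffOp k A m := by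
  -- The cocycle identity, read as a formula for a bracket. Comparing orders shows that `a ↦ σ(E a)`
  -- is a derivation; with the symmetry of `E` it gives `[E a, b] = [E b, a]`, the closedness of the
  -- family of symbols.
  have hbr : ∀ a b, bracket k b (E a) = E (a * b) - a • E b - b • E a + E a b • 1 := by
    intro a b
    ext c
    simp only [bracket_apply, LinearMap.add_apply, LinearMap.sub_apply, LinearMap.smul_apply,
      smul_eq_mul, Module.End.one_apply]
    linear_combination hcocycle a b c
  let d : Derivation k A (SymDual A Ω[A⁄k]) := Derivation.mk'
    { toFun := fun a => thetaForm (m + 1) ⟨E a, hm a⟩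
      map_add' := fun a b => by
        rw [← map_add]
        congr 1
        exact Subtype.ext (E.map_add a b)
      map_smul' := fun c a => by
        rw [RingHom.id_apply, ← algebraMap_smul A c (thetaForm (m + 1) _), ← map_smul]
        congr 1
        refine Subtype.ext ((E.map_smul c a).trans ?_)
        exact (algebraMap_smul A c (E a)).symm }
    (fun a b => by
      change thetaForm (m + 1) _ = a • thetaForm (m + 1) _ + b • thetaForm (m + 1) _
      rw [← map_smul, ← map_smul, ← map_add, ← sub_eq_zero, ← map_sub]
      refine thetaForm_eq_zero _ ?_
      change E (a * b) - (a • E b + b • E a) ∈ diffOp k A m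
      have : E (a * b) - (a • E b + b • E a) = bracket k b (E a) - E a b • 1 := by
        rw [hbr]; abel
      rw [this]
      exact sub_mem (hm a b) (Submodule.smul_mem _ _ (one_mem_diffOp m)))
  have hd : ∀ a, d.liftKaehlerDifferential (KaehlerDifferential.D k A a) =
      thetaForm (m + 1) ⟨E a, hm a⟩ := fun a => Derivation.liftKaehlerDifferential_comp_D d a
  have hspan : ∀ x : Ω[A⁄k], x ∈ Submodule.span A (Set.range (KaehlerDifferential.D k A)) :=
    fun x => by rw [KaehlerDifferential.span_range_derivation]; trivial
  -- Closedness is linear in `x` and in `y`, so it reduces to `x = da` and `y = db`, where it is the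
  -- equality of the two brackets.
  obtain ⟨u, hu⟩ := exists_contract_eq d.liftKaehlerDifferential (by
    intro x y t
    induction hspan x using Submodule.span_induction with
    | mem x hx =>
      obtain ⟨a, rfl⟩ := hx
      induction hspan y using Submodule.span_induction with
      | mem y hy =>
        obtain ⟨b, rfl⟩ := hy
        rw [hd, hd, ← contract_eval_apply, ← contract_eval_apply, contract_thetaForm_succ,
          contract_thetaForm_succ]
        have : bracket k b (E a) = bracket k a (E b) := by
          rw [hbr, hbr, mul_comm a b, hsymm a b]; abel
        simp only [this]
      | zero => simp
      | add y z _ _ hy hz =>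
        rw [map_add, add_mul, map_add, hy, hz, map_add]; rfl
      | smul a y _ hy => rw [map_smul, smul_mul_assoc, map_smul, hy, map_smul]; rfl
    | zero => simp
    | add x z _ _ hx hz => rw [map_add, map_add, add_mul, map_add, ← hx, ← hz]; rfl
    | smul a x _ hx => rw [map_smul, map_smul, smul_mul_assoc, map_smul, ← hx]; rfl)
  obtain ⟨q, hq⟩ := hθ (DualPiece.restrict (m + 2) u)
  obtain ⟨Q, rfl⟩ := GrPiece.mk_surjective (m + 2) q
  refine ⟨Q, fun a => ?_⟩
  have hQ : thetaForm (m + 1) ⟨bracket k a Q, Q.2 a⟩ = thetaForm (m + 1) ⟨E a, hm a⟩ := by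
    rw [← contract_thetaForm_succ, thetaForm_def (m + 2), hq]
    refine WithConv.ext (symPiece_hom_ext fun l t ht => ?_)
    change (DualPiece.restrict (m + 2) u).extend (ι A _ (KaehlerDifferential.D k A a) * t) =
      thetaForm (m + 1) ⟨E a, hm a⟩ t
    have ht' := ι_mul_mem_symPiece (KaehlerDifferential.D k A a) ht
    by_cases h : l = m + 1
    · subst h
      rw [extend_restrict_apply u ht', hu, hd]
    · rw [DualPiece.extend_of_ne _ (by omega) ht', thetaForm_of_ne _ h ht]
  rw [← sub_eq_zero, ← map_sub] at hQ
  exact mem_diffOpPred_of_thetaForm_eq_zero _ hQ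

/-- If all `θ_n` are surjective, a normalized symmetric Hochschild cocycle with values in
differential operators is a coboundary. -/
theorem exists_coboundary (hθ : ∀ n, Function.Surjective (thetaPiece k A n)) (m : ℕ)
    (E : A →ₗ[k] Module.End k A) (hm : ∀ a, E a ∈ diffOp k A m)
    (hsymm : ∀ a b, E a b = E b a) (hone : ∀ a, E a 1 = 0)
    (hcocycle : ∀ a b c, a * E b c + E a (b * c) = E (a * b) c + E a b * c) :
    ∃ Q : Module.End k A, ∀ a b, Q (a * b) = a * Q b + Q a * b + E a b := by
  induction m generalizing E with
  | zero =>
    -- An operator of order zero is multiplication by its value at `1`, so normalization forces `E =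
    -- 0`.
    refine ⟨0, fun a b => ?_⟩
    have := hm a b 1
    rw [mul_one, hone, mul_zero] at this
    simp [this]
  | succ m ih =>
    obtain ⟨Q₀, hQ₀⟩ := exists_bracket_sub_mem (hθ _) hm hsymm hcocycle
    -- Subtracting the constant `Q₀(1)` leaves all brackets unchanged and makes `Q(1) = 0`, so that
    -- the corrected cocycle `E'` stays normalized.
    let Q : Module.End k A := Q₀ - (Q₀ : Module.End k A) 1 • 1
    have hQ1 : Q 1 = 0 := by simp [Q]
    let E' : A →ₗ[k] Module.End k A := LinearMap.mk₂ k
      (fun a b => E a b - (Q (a * b) - a * Q b - Q a * b))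
      (fun a a' b => by simp only [map_add, LinearMap.add_apply, add_mul]; ring)
      (fun c a b => by
        simp only [map_smul, LinearMap.smul_apply, smul_mul_assoc, smul_sub])
      (fun a b b' => by simp only [map_add, mul_add]; ring)
      (fun c a b => by simp only [map_smul, mul_smul_comm, smul_sub])
    have hE' : ∀ a b, E' a b = E a b - (Q (a * b) - a * Q b - Q a * b) := fun a b => rfl
    -- Subtracting the coboundary of `Q` preserves symmetry and the cocycle identity, and lowers the
    -- order because `[Q₀, a]` agrees with `E a` up to order `m`.
    obtain ⟨Q', hQ'⟩ := ih E' (fun a => by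
        have : E' a = -(bracket k a Q₀ - E a) + Q a • 1 := by
          ext b
          rw [hE']
          simp [Q, bracket_apply]
          ring
        rw [this]
        exact add_mem (neg_mem (hQ₀ a)) (Submodule.smul_mem _ _ (one_mem_diffOp m)))
      (fun a b => by rw [hE', hE', hsymm, mul_comm a b]; ring)
      (fun a => by rw [hE', hone, hQ1, mul_one, mul_one]; ring)
      (fun a b c => by
        simp only [hE', mul_assoc]
        linear_combination hcocycle a b c)
    refine ⟨Q' + Q, fun a b => ?_⟩
    have := hQ' a b
    rw [hE'] at this
    simp only [LinearMap.add_apply]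
    linear_combination this

/-- Hasse-Schmidt derivations of length `n`, continued by zero. -/
structure IsTruncatedHS (n : ℕ) (D : ℕ → Module.End k A) : Prop where
  zero_eq : D 0 = 1
  eq_zero : ∀ i, n < i → D i = 0
  map_one : ∀ i, D (i + 1) 1 = 0
  mem_diffOp : ∀ i, D i ∈ diffOp k A i
  leibniz : ∀ i ≤ n, ∀ x y,
    D i (x * y) = ∑ p ∈ Finset.HasAntidiagonal.antidiagonal i, D p.1 x * D p.2 y

/-- The series `∑ D_i(x) T^i`. -/
def hsSeries (D : ℕ → Module.End k A) (x : A) : PowerSeries A := PowerSeries.mk fun i => D i x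

theorem coeff_succ_mul_of_coeff_eq_zero {n : ℕ} {f : PowerSeries A}
    (hf : ∀ i ≤ n, PowerSeries.coeff i f = 0) (g : PowerSeries A) :
    PowerSeries.coeff (n + 1) (f * g) = PowerSeries.coeff (n + 1) f * PowerSeries.coeff 0 g := by
  rw [PowerSeries.coeff_mul, Finset.sum_eq_single (n + 1, 0)]
  · rintro ⟨i, j⟩ h hne
    have h' : i + j = n + 1 := Finset.HasAntidiagonal.mem_antidiagonal.1 h
    have : i ≤ n := by
      by_contra hi
      exact hne (Prod.ext (by simp; omega) (by simp; omega))
    simp [hf i this]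
  · intro h
    exact absurd (Finset.HasAntidiagonal.mem_antidiagonal.2 (add_zero _)) h

/-- If all `θ_n` are surjective, a Hasse-Schmidt derivation of finite length can be extended. -/
theorem IsTruncatedHS.exists_extension (hθ : ∀ n, Function.Surjective (thetaPiece k A n)) {n : ℕ}
    {D : ℕ → Module.End k A} (hD : IsTruncatedHS (n + 1) D) :
    ∃ D' : ℕ → Module.End k A, IsTruncatedHS (n + 2) D' ∧ ∀ i ≤ n + 1, D' i = D i := by
  -- Since `D (n + 2) = 0`, only terms with both indices positive survive: `E` is the defect in
  -- `Q(ab) = a Q(b) + Q(a) b + E(a, b)` that the new component `Q` must satisfy.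
  let E : A →ₗ[k] Module.End k A := LinearMap.mk₂ k
    (fun a b => ∑ p ∈ Finset.HasAntidiagonal.antidiagonal (n + 2), D p.1 a * D p.2 b)
    (fun a a' b => by simp only [map_add, add_mul, Finset.sum_add_distrib])
    (fun c a b => by simp only [map_smul, smul_mul_assoc, Finset.smul_sum])
    (fun a b b' => by simp only [map_add, mul_add, Finset.sum_add_distrib])
    (fun c a b => by simp only [map_smul, mul_smul_comm, Finset.smul_sum])
  have hE : ∀ a b, E a b = ∑ p ∈ Finset.HasAntidiagonal.antidiagonal (n + 2),
      D p.1 a * D p.2 b := fun a b => rfl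
  have hE' : ∀ a b, E a b = PowerSeries.coeff (n + 2) (hsSeries D a * hsSeries D b) :=
    fun a b => by simp [hE, PowerSeries.coeff_mul, hsSeries]
  have hlow : ∀ a b, ∀ i ≤ n + 1,
      PowerSeries.coeff i (hsSeries D a * hsSeries D b - hsSeries D (a * b)) = 0 := by
    intro a b i hi
    rw [map_sub, sub_eq_zero, PowerSeries.coeff_mul]
    simp [hsSeries, hD.leibniz i hi]
  have htop : ∀ a b, PowerSeries.coeff (n + 2)
      (hsSeries D a * hsSeries D b - hsSeries D (a * b)) = E a b := by
    intro a b
    rw [map_sub, ← hE']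
    simp [hsSeries, hD.eq_zero (n + 2) (by omega)]
  have hs0 : ∀ a, PowerSeries.coeff 0 (hsSeries D a) = a := fun a => by
    rw [hsSeries, PowerSeries.coeff_mk, hD.zero_eq, Module.End.one_apply]
  have hs1 : hsSeries D 1 = 1 := by
    ext i
    rw [hsSeries, PowerSeries.coeff_mk, PowerSeries.coeff_one]
    rcases i with _ | i
    · rw [hD.zero_eq]; simp
    · rw [hD.map_one]; simp
  -- The series of `a` times that of `b` differs from the series of `ab` first in degree `n + 2`, by
  -- `E(a, b)`. The cocycle identity compares this leading term for the two bracketings of a triple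
  -- product.
  have hcocycle : ∀ a b c, a * E b c + E a (b * c) = E (a * b) c + E a b * c := by
    intro a b c
    have h1 := coeff_succ_mul_of_coeff_eq_zero (hlow b c) (hsSeries D a)
    have h2 := coeff_succ_mul_of_coeff_eq_zero (hlow a b) (hsSeries D c)
    rw [htop, hs0, sub_mul, map_sub] at h1 h2
    rw [hE' a (b * c), hE' (a * b) c]
    rw [mul_comm (hsSeries D (b * c)), mul_comm (hsSeries D b * hsSeries D c), ← mul_assoc] at h1
    linear_combination h2 - h1
  have hone : ∀ a, E a 1 = 0 := fun a => by
    rw [hE', hs1, mul_one, hsSeries, PowerSeries.coeff_mk, hD.eq_zero (n + 2) (by omega)]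
    rfl
  have hmem : ∀ a, E a ∈ diffOp k A (n + 1) := by
    intro a
    have : E a = ∑ p ∈ Finset.HasAntidiagonal.antidiagonal (n + 2), D p.1 a • D p.2 := by
      ext b
      simp [hE]
    rw [this]
    -- The term with second index `n + 2` is zero, so the order is at most `n + 1`.
    refine sum_mem fun p hp => Submodule.smul_mem _ _ ?_
    have := Finset.HasAntidiagonal.mem_antidiagonal.1 hp
    by_cases h : p.2 ≤ n + 1
    · exact diffOp_mono h (hD.mem_diffOp _)
    · rw [hD.eq_zero _ (by omega)]
      exact zero_mem _
  obtain ⟨Q, hQ⟩ := exists_coboundary hθ (n + 1) E hmem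
    (fun a b => by rw [hE', hE', mul_comm]) hone hcocycle
  have hsame : ∀ i, i ≠ n + 2 → Function.update D (n + 2) Q i = D i :=
    fun i hi => Function.update_of_ne hi _ _
  refine ⟨Function.update D (n + 2) Q, ⟨?_, fun i hi => ?_, fun i => ?_, fun i => ?_,
    fun i hi x y => ?_⟩, fun i hi => hsame i (by omega)⟩
  · rw [hsame 0 (by omega), hD.zero_eq]
  · rw [hsame i (by omega), hD.eq_zero i (by omega)]
  · by_cases h : i = n + 1
    · subst h
      rw [Function.update_self]
      have := hQ 1 1
      rw [hone, mul_one, mul_one, one_mul] at this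
      linear_combination -this
    · rw [hsame _ (by omega), hD.map_one]
  · by_cases h : i = n + 2
    · subst h
      rw [Function.update_self]
      intro a
      have : bracket k a Q = E a + Q a • 1 := by
        ext b
        rw [bracket_apply, hQ]
        simp
        ring
      rw [this]
      exact add_mem (hmem a) (Submodule.smul_mem _ _ (one_mem_diffOp _))
    · rw [hsame _ h]
      exact hD.mem_diffOp i
  · by_cases h : i = n + 2
    · subst h
      have hmid : ∀ p ∈ Finset.HasAntidiagonal.antidiagonal n,
          Function.update D (n + 2) Q (p.1 + 1) x * Function.update D (n + 2) Q (p.2 + 1) y =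
          D (p.1 + 1) x * D (p.2 + 1) y := by
        intro p hp
        have := Finset.HasAntidiagonal.mem_antidiagonal.1 hp
        rw [hsame _ (by omega), hsame _ (by omega)]
      rw [Function.update_self, hQ, hE, Finset.Nat.antidiagonal_succ_succ']
      simp only [Finset.sum_cons, Finset.sum_map, Function.Embedding.prodMap,
        Function.Embedding.coeFn_mk, Prod.map, Nat.succ_eq_add_one]
      rw [Finset.sum_congr rfl hmid, Function.update_self, hsame 0 (by omega), hD.zero_eq,
        hD.eq_zero (n + 2) (by omega)]
      simp
      ring
    · rw [hsame i h, hD.leibniz i (by omega)]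
      refine Finset.sum_congr rfl fun p hp => ?_
      have := Finset.HasAntidiagonal.mem_antidiagonal.1 hp
      rw [hsame _ (by omega), hsame _ (by omega)]

theorem isTruncatedHS_of_derivation (δ : Derivation k A A) :
    IsTruncatedHS 1 fun i : ℕ => if i = 0 then (1 : Module.End k A) else
      if i = 1 then (δ : A →ₗ[k] A) else 0 where
  zero_eq := rfl
  eq_zero i hi := by rw [if_neg (by omega), if_neg (by omega)]
  map_one i := by
    rw [if_neg (by omega)]
    split_ifs <;> simp
  mem_diffOp i := by
    rcases i with _ | _ | i
    · exact one_mem_diffOp 0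
    · intro a b x
      simp [bracket_apply]
      ring
    · exact zero_mem _
  leibniz i hi x y := by
    obtain rfl | rfl : i = 0 ∨ i = 1 := by omega
    · simp
    · simp [Finset.Nat.antidiagonal_succ]
      ring

/-- If all `θ_n` are surjective, every derivation is integrable. -/
theorem isIntegrable_of_surjective (hθ : ∀ n, Function.Surjective (thetaPiece k A n))
    (δ : Derivation k A A) : IsIntegrable δ := by
  choose ext hext hext' using fun (n : ℕ) (D : {D : ℕ → Module.End k A // IsTruncatedHS (n + 1) D}) =>
    D.2.exists_extension hθ
  let F : (n : ℕ) → {D : ℕ → Module.End k A // IsTruncatedHS (n + 1) D} := fun n =>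
    Nat.rec ⟨_, isTruncatedHS_of_derivation δ⟩ (fun n D => ⟨ext n D, hext n D⟩) n
  have hstep : ∀ n i, i ≤ n + 1 → (F (n + 1)).1 i = (F n).1 i := fun n i hi =>
    hext' n (F n) i hi
  have hF : ∀ i n, i ≤ n → (F n).1 i = (F i).1 i := by
    intro i n hin
    induction n, hin using Nat.le_induction with
    | base => rfl
    | succ n hn ih => rw [hstep n i (by omega), ih]
  -- The diagonal sequence: the component of index `i` no longer changes from stage `i` on, and
  -- stage `n` satisfies the Leibniz rule up to index `n + 1`.
  refine ⟨⟨fun i => (F i).1 i, rfl, fun n x y => ?_⟩, ?_⟩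
  · rw [(F n).2.leibniz n (by omega)]
    refine Finset.sum_congr rfl fun p hp => ?_
    have := Finset.HasAntidiagonal.mem_antidiagonal.1 hp
    rw [hF p.1 n (by omega), hF p.2 n (by omega)]
  · exact hstep 0 1 le_rfl

end Integrability

/-! ### The equivalences -/

section Equivalence

open SymmetricAlgebra WithConv

variable {k A : Type*} [CommRing k] [CommRing A] [Algebra k A]

/-- In degree one the divided powers of degree at least two vanish and products obey the Leibniz
rule at `1`. Hence the degree-one part of any form coming from `Γ IDer` is the linear form of an
integrable derivation; applied to a preimage of `σ_1(δ)`, this gives the integrability of `δ`. -/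
theorem ider_eq_top_of_vartheta_surjective (h : Function.Surjective (vartheta k A)) :
    IDer k A = ⊤ := by
  have key : ∀ z : DividedPowerAlgebra A (IDer k A),
      ∃ ε : IDer k A, ∀ x, dpHom (iderToDual k A) z (ι A _ x * 1) = iderToDual k A ε x := by
    intro z
    have hmul : ∀ (u v : SymDual A Ω[A⁄k]) x, (u * v) (ι A _ x * 1) =
        u (ι A _ x * 1) * v 1 + u 1 * v (ι A _ x * 1) := by
      intro u v x
      rw [← contract_eval_apply, contract_mul, ← contract_eval_apply, ← contract_eval_apply,
        ← symDual_mul_one_apply, ← symDual_mul_one_apply]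
      rfl
    induction z using DividedPowerAlgebra.induction_on with
    | C a =>
      refine ⟨0, fun x => ?_⟩
      rw [AlgHom.commutes, Algebra.algebraMap_eq_smul_one, ← contract_eval_apply, map_smul,
        contract_one, smul_zero, map_zero]
      rfl
    | add z w hz hw =>
      obtain ⟨ε, hε⟩ := hz
      obtain ⟨ε', hε'⟩ := hw
      refine ⟨ε + ε', fun x => ?_⟩
      rw [map_add, map_add, LinearMap.add_apply, ← hε, ← hε']
      rfl
    | dp z n δ hz =>
      obtain ⟨ε, hε⟩ := hz
      rw [map_mul, dpHom_dp]
      rcases n with _ | _ | n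
      · rw [dpForm_zero, mul_one]
        exact ⟨ε, hε⟩
      · refine ⟨dpHom (iderToDual k A) z 1 • δ, fun x => ?_⟩
        rw [hmul, dpForm_ι_mul, dpForm_succ_one, dpForm_zero, symDual_one_one, map_smul]
        simp
      · refine ⟨0, fun x => ?_⟩
        rw [hmul, dpForm_ι_mul, dpForm_succ_one, dpForm_succ_one]
        simp
  rw [eq_top_iff]
  rintro δ -
  have hmem : (δ : A →ₗ[k] A) ∈ diffOp k A 1 := (isTruncatedHS_of_derivation δ).mem_diffOp 1
  obtain ⟨z, hz⟩ := h (symbol 1 ⟨_, hmem⟩)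
  obtain ⟨ε, hε⟩ := key z
  have : δ = ε := by
    ext a
    have h1 := hε (KaehlerDifferential.D k A a)
    rw [← extendHom_theta_vartheta, hz, extendHom_theta_symbol, iderToDual_D,
      ← contract_eval_apply, contract_thetaForm_succ, thetaForm_zero_one] at h1
    rw [← h1]
    -- The remaining identity is `[δ, a](1) = δ(a)`, as `δ(1) = 0`.
    simp [bracket_apply]
  rw [this]
  exact ε.2

/-- With all derivations integrable, `IDer = Der` is the dual of `Ω` and is finitely generated
projective, so the results on `dpHom` apply to the composite. -/
theorem theta_comp_vartheta_bijective [Module.Finite A (Derivation k A A)]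
    [Module.Projective A (Derivation k A A)] (h : IDer k A = ⊤) :
    Function.Bijective (theta k A ∘ vartheta k A) := by
  let e : IDer k A ≃ₗ[A] Derivation k A A := LinearEquiv.ofTop (IDer k A) h
  have : Module.Finite A (IDer k A) := Module.Finite.equiv e.symm
  have : Module.Projective A (IDer k A) := Module.Projective.of_equiv e.symm
  let j : IDer k A ≃ₗ[A] Module.Dual A Ω[A⁄k] :=
    e.trans (KaehlerDifferential.linearMapEquivDerivation k A).symm
  have hcomp : ∀ z, extendHom A _ (theta k A (vartheta k A z)) = dpHom j.toLinearMap z :=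
    extendHom_theta_vartheta
  refine ⟨fun z w hzw => dpHom_injective j ?_, fun x => ?_⟩
  · rw [← hcomp, ← hcomp]
    exact congrArg _ hzw
  · induction x using DirectSum.induction_on with
    | zero => exact ⟨0, by simp⟩
    | of n u =>
      obtain ⟨z, hz⟩ := mem_range_dpHom j (n := n) (u := u.extend)
        fun m hm s hs => u.extend_of_ne hm hs
      refine ⟨z, extendHom_injective ?_⟩
      rw [extendHom_of, ← hz, ← hcomp]
      rfl
    | add x y hx hy =>
      obtain ⟨z, rfl⟩ := hx
      obtain ⟨w, rfl⟩ := hy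
      exact ⟨z + w, by simp⟩

end Equivalence

end HSInt
end

theorem mainTheorem1 {k A : Type*} [CommRing k] [CommRing A] [Algebra k A]
    [Module.Finite A (Derivation k A A)] [Module.Projective A (Derivation k A A)] :
    List.TFAE
      [∃ e : HSInt.GrDiff k A ≃ₐ[A] HSInt.GradedDual A Ω[A⁄k], ∀ x, e x = HSInt.theta k A x,
       Function.Bijective (HSInt.vartheta k A),
       HSInt.IDer k A = ⊤] := by
  tfae_have 1 → 3 := by
    rintro ⟨e, he⟩
    have hθ : Function.Surjective (HSInt.theta k A) := fun y =>
      ⟨e.symm y, by rw [← he, e.apply_symm_apply]⟩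
    rw [eq_top_iff]
    exact fun δ _ =>
      HSInt.isIntegrable_of_surjective ((DirectSum.lmap_surjective _).1 hθ) δ
  tfae_have 2 → 3 := fun h => HSInt.ider_eq_top_of_vartheta_surjective h.2
  -- Injectivity of `θ` is automatic, and its surjectivity follows from that of `θ ∘ ϑ`; cancelling
  -- the bijection `θ` then gives the bijectivity of `ϑ` for the last implication.
  tfae_have 3 → 1 := fun h =>
    ⟨AlgEquiv.ofBijective (HSInt.thetaAlgHom k A) ⟨HSInt.theta_injective k A,
      (HSInt.theta_comp_vartheta_bijective h).2.of_comp⟩, fun _ => rfl⟩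
  tfae_have 3 → 2 := fun h =>
    (Function.Bijective.of_comp_iff' ⟨HSInt.theta_injective k A,
      (HSInt.theta_comp_vartheta_bijective h).2.of_comp⟩ _).1
      (HSInt.theta_comp_vartheta_bijective h)
  tfae_finish
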